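/- Let $\Gamma$ be a finite extensive-form game with player set $N=\{1,\dots,n\}$, possibly with a chance player $c$ whose moves have fixed probabilities $f_c(a\mid h)$, and with perfect recall: for every player $i$, any two histories in the same information set of $i$ have the same record of the information sets encountered and the actions taken by $i$. Write $N_c=N\cup\{c\}$, let $A(I)$ be the set of actions at an information set $I$, let $Z$ be the set of terminal histories, and let $u^i_z:Z\to\mathbb R$ be the payoff function of $i\in N$. Equally named actions at different information sets are regarded as different; the information sets of chance are singletons. **Reduced normal form.** A pure strategy $s^i\in S^i$ of player $i$ prescribes exactly one action at each information set of $i$ that is not excluded by the player's own earlier prescriptions, and nothing at the other information sets. A mixed strategy $\sigma^i\in\Xi^i$ is a probability distribution on $S^i$, and $\Xi=\prod_{i\in N}\Xi^i$. Let $u^i(s^i,\sigma^{-i})$ be the expected payoff of $i$ from $s^i$ when the other players use $\sigma^{-i}$ and chance moves according to $f_c$. For $\varepsilon>0$, a profile $\sigma\in\Xi$ with all $\sigma^i(s^i)>0$ is an $\varepsilon$-normal-form proper equilibrium if, for all $i\in N$ and $s^i,\tilde s^i\in S^i$, $$u^i(s^i,\sigma^{-i})<u^i(\tilde s^i,\sigma^{-i})\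 \Longrightarrow\ \sigma^i(s^i)\le\varepsilon\,\sigma^i(\tilde s^i).$$ A profile $\sigma^*\in\Xi$ is a normal-form proper equilibrium if it is a limit point of a sequence of $\varepsilon^k$-normal-form proper equilibria with $\varepsilon^k>0$ and $\varepsilon^k\to0$. **Sequence form.** For $i\in N_c$ and a history $h$, the sequence $\varpi^i_h$ is the set of the actions of $i$ along $h$; $W^i$ is the set of all sequences of $i$. For an information set $I$ of $i$ let $\varpi^i_I=\varpi^i_h$ for $h\in I$, and $\varpi^i_Ia=\varpi^i_I\cup\{a\}$ for $a\in A(I)$. A realization plan $\gamma^i\in\Lambda^i$ of $i\in N$ is a function $\gamma^i:W^i\to[0,\infty)$ with $\gamma^i(\emptyset)=1$ and $\sum_{a\in A(I)}\gamma^i(\varpi^i_Ia)=\gamma^i(\varpi^i_I)$ for every information set $I$ of $i$; $\Lambda=\prod_{i\in N}\Lambda^i$. For chance, $\gamma^c(\varpi^c)$ is the product of the probabilities of the actions in $\varpi^c$. For a sequence profile $\varpi=(\varpi^i)_{i\in N_c}$ put $g^i(\varpi)=u^i_z(h)$ if $\varpi=(\varpi^j_h)_{j\in N_c}$ for some $h\in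 Z$, and $g^i(\varpi)=0$ otherwise. Let $$g^i(\varpi^i,\gamma^{-i})=\sum_{\varpi^{-i}}g^i(\varpi^i,\varpi^{-i})\prod_{j\in N_c\setminus\{i\}}\gamma^j(\varpi^j),\qquad g^i(\gamma)=\sum_{\varpi^i\in W^i}\gamma^i(\varpi^i)\,g^i(\varpi^i,\gamma^{-i}),$$ and let $$g^i_m(\varpi^i,\gamma^{-i})=\max\{g^i(\tilde\gamma^i,\gamma^{-i}):\tilde\gamma^i\in\Lambda^i,\ \tilde\gamma^i(\varpi^i)=1\}$$ be the maximal payoff attainable while committing to $\varpi^i$. For $\varepsilon>0$, a profile $\gamma\in\Lambda$ with all $\gamma^i(\varpi^i)>0$ is an $\varepsilon$-sequence-form proper equilibrium if, for all $i\in N$ and $\varpi^i,\tilde\varpi^i\in W^i$, $$g^i_m(\varpi^i,\gamma^{-i})<g^i_m(\tilde\varpi^i,\gamma^{-i})\ \Longrightarrow\ \gamma^i(\varpi^i)\le\varepsilon\,\gamma^i(\tilde\varpi^i).$$ A profile $\gamma^*\in\Lambda$ is a sequence-form proper equilibrium if it is a limit point of a sequence of $\varepsilon^k$-sequence-form proper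 equilibria with $\varepsilon^k>0$ and $\varepsilon^k\to0$. **Theorem.** Let $\sigma^*\in\Xi$, and let $\gamma^*$ be the realization plan profile induced by $\sigma^*$, that is, for $i\in N$ and $\varpi^i\in W^i$, $\gamma^{*i}(\varpi^i)$ is the sum of $\sigma^{*i}(s^i)$ over the $s^i\in S^i$ that prescribe all actions in $\varpi^i$. Then $\sigma^*$ is a normal-form proper equilibrium of $\Gamma$ if and only if $\gamma^*$ is a sequence-form proper equilibrium of $\Gamma$. -/

import Mathlib

/-! # Finite extensive-form games, their reduced normal form and their sequence form

`N` is the type of (non-chance) players, `α` the type of actions. The acting parties are the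
elements of `Option N`: `some i` is player `i` and `none` is chance. -/

/-- A finite set of histories. A history is the list of the actions taken so far, **most recent
action first**: `a :: h` is the history `h` followed by the action `a`. The set contains the empty
history and is closed under deleting the last action. -/
structure GameTree (α : Type*) where
  /-- the finite set of histories -/
  H : Finset (List α)
  nil_mem : [] ∈ H
  tail_mem : ∀ (a : α) (h : List α), a :: h ∈ H → h ∈ H

namespace GameTree

variable {α : Type*} [DecidableEq α] (T : GameTree α)

/-- `A(h)`, the finite set of actions available after the history `h`. -/
def actions (h : List α) : Finset α :=
  (T.H.biUnion List.toFinset).filter fun a => a :: h ∈ T.H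

theorem mem_actions {h : List α} {a : α} : a ∈ T.actions h ↔ a :: h ∈ T.H := by
  simp only [actions, Finset.mem_filter, Finset.mem_biUnion, List.mem_toFinset]
  exact ⟨fun x => x.2, fun x => ⟨⟨a :: h, x, List.mem_cons_self⟩, x⟩⟩

/-- `Z`, the finite set of terminal histories. -/
def Z : Finset (List α) := T.H.filter fun h => T.actions h = ∅

end GameTree

/-- A finite extensive-form game: a tree of histories, the party moving after each nonterminal
history, the probabilities of the chance moves, the information partitions of the players and
their payoffs. The values of `mover` and `payoff` outside the nonterminal, respectively terminal,
histories are never used. -/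
structure ExtensiveGame (N α : Type*) [DecidableEq N] [DecidableEq α] extends GameTree α where
  /-- the party (`none` is chance) that moves after a nonterminal history -/
  mover : List α → Option N
  /-- `chance h a` is the probability that chance takes the action `a` after `h` -/
  chance : List α → α → ℝ
  chance_nonneg : ∀ h ∈ toGameTree.H, mover h = none → ∀ a ∈ toGameTree.actions h, 0 ≤ chance h a
  chance_sum : ∀ h ∈ toGameTree.H, (toGameTree.actions h).Nonempty → mover h = none →
    ∑ a ∈ toGameTree.actions h, chance h a = 1
  /-- the information partition of each player: a partition of the set of nonterminal histories
  after which the player moves -/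
  info : ∀ i : N, Finpartition
    (toGameTree.H.filter fun h => (toGameTree.actions h).Nonempty ∧ mover h = some i)
  /-- the same actions are available at all histories of an information set -/
  actions_eq : ∀ (i : N), ∀ I ∈ (info i).parts, ∀ h ∈ I, ∀ h' ∈ I,
    toGameTree.actions h = toGameTree.actions h'
  /-- the payoff of each player at each terminal history -/
  payoff : N → List α → ℝ

namespace ExtensiveGame

variable {N α : Type*} [DecidableEq N] [DecidableEq α] (G : ExtensiveGame N α)

/-- The nonterminal histories after which the party `j` moves. -/
def nodes (j : Option N) : Finset (List α) :=
  G.H.filter fun h => (G.actions h).Nonempty ∧ G.mover h = j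

/-- The information set of the party `j` that contains the history `h`. The information sets of
chance are singletons. -/
def cell : Option N → List α → Finset (List α)
  | none, h => {h}
  | some i, h => (G.info i).part h

/-- `R_j(h)`, the record of the experience of the party `j` along the history `h`: the information
sets that `j` encounters and the actions that `j` takes there, in order (most recent first). -/
def record (j : Option N) : List α → List (Finset (List α) × α)
  | [] => []
  | a :: h => if G.mover h = j then (G.cell j h, a) :: record j h else record j h

/-- Perfect recall: histories in the same information set of a player have the same record. -/
def PerfectRecall : Prop :=
  ∀ (i : N), ∀ I ∈ (G.info i).parts, ∀ h ∈ I, ∀ h' ∈ I,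
    G.record (some i) h = G.record (some i) h'

/-! ### The reduced normal form -/

/-- The sequence of the party `j` at the history `h`: the set of the moves of `j` along `h`. A move
is an action together with the information set at which it is taken, so that equally named actions
at different information sets are kept apart. -/
def seqSet (j : Option N) (h : List α) : Finset (Finset (List α) × α) :=
  (G.record j h).toFinset

/-- All moves of player `i`: the pairs of an information set `I` and an action of `A(I)`. -/
def moves (i : N) : Finset (Finset (List α) × α) :=
  (G.nodes (some i)).biUnion fun h => (G.actions h).image fun a => (G.cell (some i) h, a)

/-- The set of moves `s` is (the graph of) a pure strategy of player `i` in the reduced normal form: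
it prescribes exactly one action at each information set that is not excluded by the own earlier
prescriptions of `s`, and no action at any other information set. -/
def IsPure (i : N) (s : Finset (Finset (List α) × α)) : Prop :=
  s ⊆ G.moves i ∧ ∀ h ∈ G.nodes (some i),
    (G.seqSet (some i) h ⊆ s → ∃! a, (G.cell (some i) h, a) ∈ s) ∧
    (∀ a, (G.cell (some i) h, a) ∈ s → G.seqSet (some i) h ⊆ s)

open Classical in
/-- `S^i`, the finite set of pure strategies of player `i` in the reduced normal form. -/
noncomputable def pureStrategies (i : N) : Finset (Finset (Finset (List α) × α)) :=
  (G.moves i).powerset.filter (G.IsPure i)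

/-- The type of pure strategies of player `i` in the reduced normal form. -/
abbrev Pure (i : N) : Type _ := {s // s ∈ G.pureStrategies i}

/-- The type of pure strategies of chance: an action at each chance history. -/
abbrev ChancePure : Type _ := ∀ h : {h // h ∈ G.nodes none}, {a // a ∈ G.actions h.1}

open Classical in
/-- The product of the indicators that the pure strategy profile `(s, sc)` takes the actions of a
history; it is `1` if the history is played under `(s, sc)` and `0` if not. -/
noncomputable def played (s : ∀ i, G.Pure i) (sc : G.ChancePure) : List α → ℝ
  | [] => 1
  | a :: h => played s sc h *
      match G.mover h with
      | none => if ∃ hh : h ∈ G.nodes none, (sc ⟨h, hh⟩ : α) = a then 1 else 0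
      | some i => if (G.cell (some i) h, a) ∈ (s i).1 then 1 else 0

/-- `u^i(s)`, the payoff of player `i` under a pure strategy profile (chance included). -/
noncomputable def purePayoff (i : N) (s : ∀ i, G.Pure i) (sc : G.ChancePure) : ℝ :=
  ∑ h ∈ G.Z, G.payoff i h * G.played s sc h

/-- `σ^c`, the mixed strategy of chance. -/
noncomputable def chanceMixed (sc : G.ChancePure) : ℝ :=
  ∏ h : {h // h ∈ G.nodes none}, G.chance h.1 (sc h).1

/-- Real-valued functions on the pure strategies of the players; the mixed strategy profiles are
those in `mixedProfiles`. -/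
abbrev MixedProfile : Type _ := ∀ i : N, G.Pure i → ℝ

/-- `Ξ`, the set of mixed strategy profiles. -/
def mixedProfiles : Set G.MixedProfile :=
  {σ | ∀ i, (∀ s, 0 ≤ σ i s) ∧ ∑ s, σ i s = 1}

/-- `u^i(s^i, σ^{-i})`, the expected payoff of player `i` from the pure strategy `si` when the other
players play `σ` and chance plays `σ^c`. It does not depend on `σ i`. -/
noncomputable def mixedPayoff [Fintype N] (i : N) (si : G.Pure i) (σ : G.MixedProfile) : ℝ :=
  ∑ s : (∀ j, G.Pure j) with s i = si, ∑ sc : G.ChancePure,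
    G.purePayoff i s sc * (G.chanceMixed sc * ∏ j ∈ Finset.univ.erase i, σ j (s j))

/-- `σ` is an `ε`-normal-form proper equilibrium. -/
def IsEpsNormalFormProper [Fintype N] (ε : ℝ) (σ : G.MixedProfile) : Prop :=
  σ ∈ G.mixedProfiles ∧ (∀ i s, 0 < σ i s) ∧
    ∀ (i : N) (s s' : G.Pure i), G.mixedPayoff i s σ < G.mixedPayoff i s' σ → σ i s ≤ ε * σ i s'

/-- `σ` is a normal-form proper equilibrium: a limit point of a sequence of `ε k`-normal-form proper
equilibria with `ε k > 0` tending to `0`. -/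
def IsNormalFormProper [Fintype N] (σ : G.MixedProfile) : Prop :=
  σ ∈ G.mixedProfiles ∧ ∃ (ε : ℕ → ℝ) (τ : ℕ → G.MixedProfile),
    (∀ k, 0 < ε k) ∧ Filter.Tendsto ε Filter.atTop (nhds 0) ∧
    (∀ k, G.IsEpsNormalFormProper (ε k) (τ k)) ∧ MapClusterPt σ Filter.atTop τ

/-! ### The sequence form -/

/-- `W^j`, the type of sequences of the party `j`. -/
abbrev Seq (j : Option N) : Type _ := {w // w ∈ G.H.image (G.seqSet j)}

/-- The sequence of the party `j` at a history. -/
def seqAt (j : Option N) (h : List α) (hh : h ∈ G.H) : G.Seq j :=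
  ⟨G.seqSet j h, Finset.mem_image_of_mem _ hh⟩

/-- Real-valued functions on the sequences of the players; the realization plan profiles are those
in `planProfiles`. -/
abbrev PlanProfile : Type _ := ∀ i : N, G.Seq (some i) → ℝ

/-- `Λ^i`, the set of realization plans of player `i`. At a history `h` in an information set `I` of
player `i`, `seqAt (some i) h` is the sequence leading to `I`, and the sequence at `a :: h` is its
extension by the action `a` at `I`. -/
def plans (i : N) : Set (G.Seq (some i) → ℝ) :=
  {γ | γ (G.seqAt (some i) [] G.nil_mem) = 1 ∧ (∀ w, 0 ≤ γ w) ∧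
    ∀ h (hh : h ∈ G.nodes (some i)),
      ∑ a : {a // a ∈ G.actions h}, γ (G.seqAt (some i) (a.1 :: h) (G.mem_actions.1 a.2)) =
        γ (G.seqAt (some i) h (Finset.mem_filter.1 hh).1)}

/-- `Λ`, the set of realization plan profiles. -/
def planProfiles : Set G.PlanProfile := {γ | ∀ i, γ i ∈ G.plans i}

/-- `γ^c`, the realization plan of chance: the product of the probabilities of the moves in the
sequence. A move of chance is a pair of a singleton `{h}` and an action `a`, of probability
`chance h a`. -/
noncomputable def chancePlan (w : G.Seq none) : ℝ :=
  ∏ m ∈ w.1, ∏ h ∈ m.1, G.chance h m.2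

/-- A realization plan profile together with the realization plan of chance. -/
noncomputable def withChance (γ : G.PlanProfile) : ∀ j : Option N, G.Seq j → ℝ
  | none => G.chancePlan
  | some i => γ i

open Classical in
/-- `g^i(ϖ)`, the payoff of player `i` at a sequence profile (chance included): the payoff at the
terminal history that defines the profile, and `0` if there is none. (With perfect recall at most
one terminal history defines a given profile.) -/
noncomputable def seqPayoff (i : N) (w : ∀ j, G.Seq j) : ℝ :=
  ∑ h ∈ G.Z with ∀ j, (w j).1 = G.seqSet j h, G.payoff i h

/-- `g^i(ϖ^i, γ^{-i})`, the expected payoff of player `i` at the sequence `wi`. It does not depend on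
`γ i`. -/
noncomputable def seqExpPayoff [Fintype N] (i : N) (wi : G.Seq (some i)) (γ : G.PlanProfile) : ℝ :=
  ∑ w : (∀ j, G.Seq j) with w (some i) = wi,
    G.seqPayoff i w * ∏ j ∈ Finset.univ.erase (some i), G.withChance γ j (w j)

/-- `g^i(γi, γ^{-i})`, the expected payoff of player `i` at the realization plan `γi`. -/
noncomputable def planPayoff [Fintype N] (i : N) (γi : G.Seq (some i) → ℝ) (γ : G.PlanProfile) : ℝ :=
  ∑ w, γi w * G.seqExpPayoff i w γ

/-- `g^i_m(ϖ^i, γ^{-i})`, the maximal expected payoff of player `i` attainable while committing to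
the sequence `w`. (With perfect recall the supremum is over a nonempty compact set, hence
a maximum.) -/
noncomputable def maxPayoff [Fintype N] (i : N) (w : G.Seq (some i)) (γ : G.PlanProfile) : ℝ :=
  sSup ((fun γi => G.planPayoff i γi γ) '' {γi | γi ∈ G.plans i ∧ γi w = 1})

/-- `γ` is an `ε`-sequence-form proper equilibrium. -/
def IsEpsSequenceFormProper [Fintype N] (ε : ℝ) (γ : G.PlanProfile) : Prop :=
  γ ∈ G.planProfiles ∧ (∀ i w, 0 < γ i w) ∧
    ∀ (i : N) (w w' : G.Seq (some i)), G.maxPayoff i w γ < G.maxPayoff i w' γ → γ i w ≤ ε * γ i w'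

/-- `γ` is a sequence-form proper equilibrium: a limit point of a sequence of `ε k`-sequence-form
proper equilibria with `ε k > 0` tending to `0`. -/
def IsSequenceFormProper [Fintype N] (γ : G.PlanProfile) : Prop :=
  γ ∈ G.planProfiles ∧ ∃ (ε : ℕ → ℝ) (η : ℕ → G.PlanProfile),
    (∀ k, 0 < ε k) ∧ Filter.Tendsto ε Filter.atTop (nhds 0) ∧
    (∀ k, G.IsEpsSequenceFormProper (ε k) (η k)) ∧ MapClusterPt γ Filter.atTop η

/-! ### From mixed strategies to realization plans -/

/-- `γ(σ)`, the realization plan profile induced by `σ`: the probability of a sequence is the total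
probability of the pure strategies that take all of its moves. -/
noncomputable def inducedPlan (σ : G.MixedProfile) : G.PlanProfile :=
  fun i w => ∑ s : G.Pure i, (if w.1 ⊆ s.1 then 1 else 0) * σ i s

/-- The set `T` of the pairs of a mixed strategy profile and the realization plan profile induced
by it. -/
def inducedPairs : Set (G.MixedProfile × G.PlanProfile) :=
  {p | p.1 ∈ G.mixedProfiles ∧ p.2 = G.inducedPlan p.1}

end ExtensiveGame

/-! Fix a player and the behaviour of all others. Under perfect recall the player's sequences form a
tree, and backward induction (`exists_loss`) assigns to each sequence a nonnegative loss `L`, the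
shortfall of its last action from the best one at that information set, such that a realization plan
`ρ` earns `V - ∑ ρ L`. A pure strategy thus costs the sum of `L` over the sequences it plays. The
best payoff under commitment to `w` is `V - pathLoss L w`: the losses up to `w` cannot be avoided,
and no others need be incurred. So both notions of properness are governed by the same `L`
(`exists_payoff_loss`, `mixedPayoff_eq`).

From normal form to sequence form: every pure strategy playing `w` costs at least `pathLoss L w`,
and some strategy playing `x` costs exactly `pathLoss L x`. Summing over the strategies that play
`w` only loses a factor, the number of pure strategies (`le_of_forall_pure_le`).

The converse has to choose among the many mixed strategies inducing a given plan `γ` near the plan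
of `σ`. `exists_mixed` builds `τ = (1 - η) σ + c + d`. The support of `σ` costs nothing. The weights
`c` are positive, tiny and sharply decreasing in cost, yet large compared with `γ w` for every `w`
costlier than the strategy (`exists_small_weights`). The weights `d` realize exactly the rest of
`γ`, using only strategies whose losses all lie on the way to one sequence `w` that they play. Such
a strategy has weight at most `γ w`, which is negligible against `c` of any cheaper strategy.
`exists_decomposition` finds `d` greedily, peeling off strategies through the costliest lossy
sequence that still has mass; because costlier sequences are much rarer, lossless continuations
never run out too early. -/

/-- The decision problem of a single player with perfect recall. `W` is the set of the sequences of
the player, ordered by extension, and `J` the set of the information sets; `par j` is the sequence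
that leads to `j` and `kids j` the set of its extensions by the actions at `j`. -/
structure DecisionTree (W J : Type*) [PartialOrder W] where
  root : W
  par : J → W
  kids : J → Finset W
  root_le : ∀ w, root ≤ w
  le_iff : ∀ j, ∀ w ∈ kids j, ∀ x, x ≤ w ↔ x = w ∨ x ≤ par j
  not_le : ∀ j, ∀ w ∈ kids j, ¬ w ≤ par j
  exists_kid : ∀ w, w ≠ root → ∃ j, w ∈ kids j
  kids_unique : ∀ j j' w, w ∈ kids j → w ∈ kids j' → j = j'
  kids_nonempty : ∀ j, (kids j).Nonempty

/-! ### Trees of sequences, flows and losses -/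

namespace DecisionTree

variable {W J : Type*} [PartialOrder W] (D : DecisionTree W J)

theorem par_lt {j : J} {w : W} (hw : w ∈ D.kids j) : D.par j < w :=
  lt_of_le_not_ge ((D.le_iff j w hw _).2 (Or.inr le_rfl)) (D.not_le j w hw)

theorem root_notMem_kids (j : J) : D.root ∉ D.kids j := fun h => D.not_le j _ h (D.root_le _)

theorem induction [Finite W] {P : W → Prop} (root : P D.root)
    (kid : ∀ j, ∀ v ∈ D.kids j, P (D.par j) → P v) (w : W) : P w := by
  induction w using WellFoundedLT.induction with
  | ind w ih =>
    by_cases h : w = D.root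
    · exact h ▸ root
    · obtain ⟨j, hj⟩ := D.exists_kid w h
      exact kid j w hj (ih _ (D.par_lt hj))

/-- A sequence passes through an information set at most once, so it determines the action taken
there. -/
theorem eq_of_mem_kids_of_le [Finite W] {j : J} {x y : W} (hx : x ∈ D.kids j) (hy : y ∈ D.kids j)
    {w : W} : x ≤ w → y ≤ w → x = y := by
  induction w using D.induction with
  | root =>
    intro h _
    rw [le_antisymm h (D.root_le x)] at hx
    exact absurd hx (D.root_notMem_kids j)
  | kid k w hw ih =>
    intro h h'
    rcases (D.le_iff k w hw x).1 h with rfl | h <;> rcases (D.le_iff k _ hw y).1 h' with rfl | h'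
    · rfl
    · obtain rfl := D.kids_unique _ _ _ hx hw
      exact absurd h' (D.not_le _ _ hy)
    · obtain rfl := D.kids_unique _ _ _ hy hw
      exact absurd h (D.not_le _ _ hx)
    · exact ih h h'

theorem sum_eq [Fintype W] [Fintype J] (f : W → ℝ) :
    ∑ w, f w = f D.root + ∑ j, ∑ w ∈ D.kids j, f w := by
  classical
  rw [← Finset.sum_biUnion, ← Finset.sum_insert]
  · refine Finset.sum_congr ?_ fun _ _ => rfl
    ext w
    simp only [Finset.mem_univ, Finset.mem_insert, Finset.mem_biUnion, true_and, true_iff]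
    exact or_iff_not_imp_left.2 (D.exists_kid w)
  · simp [D.root_notMem_kids]
  · intro j _ k _ hjk
    exact Finset.disjoint_left.2 fun w h h' => hjk (D.kids_unique _ _ _ h h')

/-- The flow equations of a realization plan. -/
def IsFlow (ρ : W → ℝ) : Prop := ∀ j, ∑ w ∈ D.kids j, ρ w = ρ (D.par j)

variable {D}

theorem IsFlow.sub {ρ ρ' : W → ℝ} (h : D.IsFlow ρ) (h' : D.IsFlow ρ') :
    D.IsFlow fun w => ρ w - ρ' w := fun j => by simp [Finset.sum_sub_distrib, h j, h' j]

theorem IsFlow.smul {ρ : W → ℝ} (h : D.IsFlow ρ) (c : ℝ) : D.IsFlow fun w => c * ρ w :=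
  fun j => by simp [← Finset.mul_sum, h j]

theorem IsFlow.sum {ι : Type*} (s : Finset ι) {ρ : ι → W → ℝ} (h : ∀ i ∈ s, D.IsFlow (ρ i)) :
    D.IsFlow fun w => ∑ i ∈ s, ρ i w := fun j => by
  rw [Finset.sum_comm]
  exact Finset.sum_congr rfl fun i hi => h i hi j

/-- An extension carries only part of the mass of its parent. Also applied to the mass removed from
a flow, `ρ₀ - ρ`. -/
theorem IsFlow.antitone [Finite W] {ρ : W → ℝ} (h : D.IsFlow ρ) (h0 : ∀ w, 0 ≤ ρ w) {x w : W} :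
    x ≤ w → ρ w ≤ ρ x := by
  induction w using D.induction with
  | root => intro hx; rw [le_antisymm hx (D.root_le x)]
  | kid k w hw ih =>
    intro hx
    rcases (D.le_iff k w hw x).1 hx with rfl | hx
    · rfl
    · refine le_trans ?_ (ih hx)
      rw [← h k]
      exact Finset.single_le_sum (fun w _ => h0 w) hw

variable (D)

/-- A loss function: nonnegative, with an action without loss at each information set. -/
structure IsLoss (L : W → ℝ) : Prop where
  nonneg : ∀ w, 0 ≤ L w
  root : L D.root = 0
  exists_zero : ∀ j, ∃ w ∈ D.kids j, L w = 0

/-- Backward induction: up to a constant, a linear functional on realization plans is minus the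
integral of a loss function. -/
theorem exists_loss [Fintype W] [Fintype J] (g : W → ℝ) :
    ∃ (V : ℝ) (L : W → ℝ), D.IsLoss L ∧
      ∀ ρ, D.IsFlow ρ → ∑ w, ρ w * g w = V * ρ D.root - ∑ w, ρ w * L w := by
  classical
  -- `V w` is the optimal value from `w` on. The recursion runs along extensions; the default `0` in
  -- `F` is never reached, since the kids of `j` lie strictly above `D.par j`.
  obtain ⟨V, hV⟩ : ∃ V : W → ℝ, ∀ w, V w = g w +
      ∑ j with D.par j = w, (D.kids j).sup' (D.kids_nonempty j) V := by
    have wf : WellFounded fun a b : W => b < a := wellFounded_gt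
    let F : ∀ w : W, (∀ x, w < x → ℝ) → ℝ := fun w r => g w +
      ∑ j with D.par j = w, (D.kids j).sup' (D.kids_nonempty j)
        fun x => if h : w < x then r x h else 0
    refine ⟨wf.fix F, fun w => ?_⟩
    rw [wf.fix_eq]
    refine congrArg _ (Finset.sum_congr rfl fun j hj => ?_)
    refine Finset.sup'_congr _ rfl fun x hx => ?_
    rw [dif_pos]
    exact (Finset.mem_filter.1 hj).2 ▸ D.par_lt hx
  set M : J → ℝ := fun j => (D.kids j).sup' (D.kids_nonempty j) V with hM
  let L : W → ℝ := fun w => if h : ∃ j, w ∈ D.kids j then M h.choose - V w else 0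
  have hL : ∀ j, ∀ w ∈ D.kids j, L w = M j - V w := fun j w hw => by
    have h : ∃ j, w ∈ D.kids j := ⟨j, hw⟩
    simp only [L, dif_pos h, D.kids_unique _ _ _ h.choose_spec hw]
  have hroot : L D.root = 0 := dif_neg fun ⟨j, hj⟩ => D.root_notMem_kids j hj
  refine ⟨V D.root, L, ⟨fun w => ?_, hroot, fun j => ?_⟩, fun ρ hρ => ?_⟩
  · by_cases h : w = D.root
    · rw [h, hroot]
    · obtain ⟨j, hj⟩ := D.exists_kid w h
      rw [hL j w hj, sub_nonneg]
      exact Finset.le_sup' V hj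
  · obtain ⟨w, hw, h⟩ := Finset.exists_mem_eq_sup' (D.kids_nonempty j) V
    exact ⟨w, hw, by rw [hL j w hw, hM]; simp [h]⟩
  -- Eliminating `g` by the recursion leaves terms `M j * ρ (D.par j)`. The flow equations spread
  -- them over the kids of `j`, where they combine with `V` into `L`, and only `V` at the root
  -- remains.
  · have h1 : ∑ w, ρ w * g w = ∑ w, ρ w * V w - ∑ j, M j * ρ (D.par j) := by
      rw [← Finset.sum_fiberwise Finset.univ D.par, ← Finset.sum_sub_distrib]
      refine Finset.sum_congr rfl fun w _ => ?_
      rw [hV w, mul_add, Finset.mul_sum, eq_sub_iff_add_eq]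
      congr 1
      refine Finset.sum_congr rfl fun j hj => ?_
      rw [(Finset.mem_filter.1 hj).2, mul_comm]
    rw [h1, D.sum_eq, D.sum_eq (fun w => ρ w * L w), hroot]
    have h2 : ∑ j, ∑ w ∈ D.kids j, ρ w * L w =
        ∑ j, M j * ρ (D.par j) - ∑ j, ∑ w ∈ D.kids j, ρ w * V w := by
      rw [← Finset.sum_sub_distrib]
      refine Finset.sum_congr rfl fun j _ => ?_
      rw [← hρ j, Finset.mul_sum, ← Finset.sum_sub_distrib]
      refine Finset.sum_congr rfl fun w hw => ?_
      rw [hL j w hw]; ring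
    rw [h2]; ring

/-! ### Pure strategies and path losses -/

/-- The set of the sequences that a pure strategy plays. -/
structure IsPure (S : Finset W) : Prop where
  root_mem : D.root ∈ S
  existsUnique_kid : ∀ j, D.par j ∈ S → ∃! w, w ∈ D.kids j ∧ w ∈ S
  par_mem : ∀ j, ∀ w ∈ D.kids j, w ∈ S → D.par j ∈ S

variable {D}

theorem IsPure.mem_of_le [Finite W] {S : Finset W} (hS : D.IsPure S) {x w : W} :
    x ≤ w → w ∈ S → x ∈ S := by
  induction w using D.induction with
  | root => intro hx h; rwa [le_antisymm hx (D.root_le x)]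
  | kid k w hw ih =>
    intro hx h
    rcases (D.le_iff k w hw x).1 hx with rfl | hx
    · exact h
    · exact ih hx (hS.par_mem k w hw h)

theorem IsPure.isFlow [DecidableEq W] {S : Finset W} (hS : D.IsPure S) :
    D.IsFlow fun w => if w ∈ S then (1 : ℝ) else 0 := fun j => by
  dsimp only
  by_cases h : D.par j ∈ S
  · obtain ⟨w, ⟨hw, hwS⟩, hu⟩ := hS.existsUnique_kid j h
    rw [if_pos h, Finset.sum_eq_single_of_mem w hw, if_pos hwS]
    intro x hx hxw
    exact if_neg fun hxS => hxw (hu x ⟨hx, hxS⟩)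
  · rw [if_neg h]
    exact Finset.sum_eq_zero fun w hw => if_neg fun hwS => h (hS.par_mem j w hw hwS)

variable (D)

/-- A pure strategy that plays `w₀` and otherwise only sequences with a property that is passed on
to some extension at each information set. -/
theorem exists_isPure [Fintype W] (w₀ : W) (R : W → Prop) (hw₀ : ∀ x ≤ w₀, R x)
    (h : ∀ j, R (D.par j) → (∀ w ∈ D.kids j, ¬ w ≤ w₀) → ∃ w ∈ D.kids j, R w) :
    ∃ S, D.IsPure S ∧ w₀ ∈ S ∧ ∀ x ∈ S, R x := by
  classical
  -- One action per information set: towards `w₀` if possible, otherwise one that preserves `R`, and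
  -- an arbitrary one where `R` already fails.
  have key : ∀ j, ∃ w ∈ D.kids j, (R (D.par j) → R w) ∧ ∀ x ∈ D.kids j, x ≤ w₀ → x = w := by
    intro j
    by_cases h1 : ∃ w ∈ D.kids j, w ≤ w₀
    · obtain ⟨w, hw, hle⟩ := h1
      exact ⟨w, hw, fun _ => hw₀ w hle, fun x hx hx' => D.eq_of_mem_kids_of_le hx hw hx' hle⟩
    · push Not at h1
      by_cases h2 : R (D.par j)
      · obtain ⟨w, hw, hR⟩ := h j h2 h1
        exact ⟨w, hw, fun _ => hR, fun x hx hx' => absurd hx' (h1 x hx)⟩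
      · obtain ⟨w, hw⟩ := D.kids_nonempty j
        exact ⟨w, hw, fun h => absurd h h2, fun x hx hx' => absurd hx' (h1 x hx)⟩
  choose f hf hfR hfu using key
  have hroot : ∀ j, ∀ x ∈ D.kids j, x ≤ D.root → x = f j := fun j x hx h =>
    absurd (le_antisymm h (D.root_le x) ▸ hx) (D.root_notMem_kids j)
  -- The sequences all of whose actions follow the choice `f`.
  let S : Finset W := Finset.univ.filter fun w => ∀ j, ∀ x ∈ D.kids j, x ≤ w → x = f j
  have hS : ∀ w, w ∈ S ↔ ∀ j, ∀ x ∈ D.kids j, x ≤ w → x = f j := fun w => by simp [S]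
  have hpar : ∀ j, ∀ w ∈ D.kids j, w ∈ S → D.par j ∈ S := fun j w hw hwS =>
    (hS _).2 fun k x hx hle => (hS w).1 hwS k x hx (hle.trans (D.par_lt hw).le)
  refine ⟨S, ⟨(hS _).2 hroot, fun j hj => ⟨f j, ⟨hf j, (hS _).2 fun k x hx hle => ?_⟩, ?_⟩, hpar⟩,
    (hS _).2 fun j x hx hle => hfu j x hx hle, fun x => ?_⟩
  · rcases (D.le_iff j _ (hf j) x).1 hle with rfl | hle
    · rw [D.kids_unique _ _ _ hx (hf j)]
    · exact (hS _).1 hj k x hx hle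
  · rintro y ⟨hy, hyS⟩
    exact (hS y).1 hyS j y hy le_rfl
  · induction x using D.induction with
    | root => exact fun _ => hw₀ _ (D.root_le _)
    | kid j w hw ih =>
      intro hwS
      rw [(hS w).1 hwS j w hw le_rfl]
      exact hfR j (ih (hpar j w hw hwS))

/-- The total loss along a sequence. -/
noncomputable def pathLoss [Fintype W] (L : W → ℝ) (w : W) : ℝ :=
  open Classical in ∑ x with x ≤ w, L x

variable {D} [Fintype W] {L : W → ℝ}

theorem pathLoss_root (hL : D.IsLoss L) : pathLoss L D.root = 0 := by
  classical
  refine Finset.sum_eq_zero fun x hx => ?_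
  rw [le_antisymm (Finset.mem_filter.1 hx).2 (D.root_le x), hL.root]

theorem pathLoss_kid {j : J} {w : W} (hw : w ∈ D.kids j) :
    pathLoss L w = L w + pathLoss L (D.par j) := by
  classical
  unfold pathLoss
  rw [← Finset.sum_insert (s := Finset.univ.filter fun x => x ≤ D.par j) (by simp [D.not_le j w hw])]
  refine Finset.sum_congr ?_ fun _ _ => rfl
  ext x
  simp [D.le_iff j w hw x]

theorem IsLoss.le_pathLoss (hL : D.IsLoss L) (w : W) : L w ≤ pathLoss L w := by
  classical
  exact Finset.single_le_sum (f := L) (fun x _ => hL.nonneg x) (by simp)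

/-- A strategy playing `w` plays all its prefixes, and losses elsewhere are nonnegative. -/
theorem IsLoss.pathLoss_le_sum (hL : D.IsLoss L) {S : Finset W} (hS : D.IsPure S) {w : W}
    (hw : w ∈ S) : pathLoss L w ≤ ∑ x ∈ S, L x := by
  classical
  exact Finset.sum_le_sum_of_subset_of_nonneg
    (fun x hx => hS.mem_of_le (Finset.mem_filter.1 hx).2 hw) fun x _ _ => hL.nonneg x

theorem sum_eq_pathLoss {S : Finset W} (hS : D.IsPure S) {w : W} (hw : w ∈ S)
    (h : ∀ x ∈ S, L x = 0 ∨ x ≤ w) : ∑ x ∈ S, L x = pathLoss L w := by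
  classical
  refine (Finset.sum_subset (fun x hx => hS.mem_of_le (Finset.mem_filter.1 hx).2 hw)
    fun x hx hxw => (h x hx).resolve_right fun hle => hxw (by simp [hle])).symm

/-- Off the path to `w`, always take an action without loss. -/
theorem IsLoss.exists_isPure_sum_eq (hL : D.IsLoss L) (w : W) :
    ∃ S, D.IsPure S ∧ w ∈ S ∧ ∑ x ∈ S, L x = pathLoss L w := by
  obtain ⟨S, hS, hw, h⟩ := D.exists_isPure w (fun x => L x = 0 ∨ x ≤ w) (fun x hx => Or.inr hx)
    fun j _ _ => (hL.exists_zero j).imp fun x hx => ⟨hx.1, Or.inl hx.2⟩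
  exact ⟨S, hS, hw, sum_eq_pathLoss hS hw h⟩


/-! ### Decomposing a flow into pure strategies -/

/-- One step of the decomposition of a flow: a pure strategy that is played with positive weight
and has no loss off one of its sequences, which is the root or the sequence of largest loss. -/
theorem exists_peel (hL : D.IsLoss L) {ρ₀ ρ : W → ℝ} (hρ₀ : D.IsFlow ρ₀) (hρ : D.IsFlow ρ)
    (hnn : ∀ w, 0 ≤ ρ w) (hle : ∀ w, ρ w ≤ ρ₀ w)
    (hgap : ∀ w x, pathLoss L x < pathLoss L w → 4 * Fintype.card W * ρ₀ w ≤ ρ₀ x)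
    (hinv : ∀ w₀, L w₀ ≠ 0 → 0 < ρ w₀ →
      (∀ w, L w ≠ 0 → 0 < ρ w → pathLoss L w ≤ pathLoss L w₀) →
      ρ₀ D.root - ρ D.root ≤
        ∑ w with L w ≠ 0 ∧ pathLoss L w₀ ≤ pathLoss L w, (ρ₀ w - ρ w))
    (hpos : 0 < ρ D.root) :
    ∃ S w₀, D.IsPure S ∧ w₀ ∈ S ∧ ∑ x ∈ S, L x = pathLoss L w₀ ∧ (∀ x ∈ S, 0 < ρ x) ∧
      ∀ w, L w ≠ 0 → 0 < ρ w → L w₀ ≠ 0 ∧ pathLoss L w ≤ pathLoss L w₀ := by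
  classical
  have fin : ∀ w₀, 0 < ρ w₀ →
      (∀ j, 0 < ρ (D.par j) → (∀ w ∈ D.kids j, ¬ w ≤ w₀) → ∃ w ∈ D.kids j, 0 < ρ w ∧ L w = 0) →
      ∃ S, D.IsPure S ∧ w₀ ∈ S ∧ ∑ x ∈ S, L x = pathLoss L w₀ ∧ (∀ x ∈ S, 0 < ρ x) := by
    intro w₀ h0 h
    obtain ⟨S, hS, hw, hR⟩ := D.exists_isPure w₀ (fun x => 0 < ρ x ∧ (L x = 0 ∨ x ≤ w₀))
      (fun x hx => ⟨h0.trans_le (hρ.antitone hnn hx), Or.inr hx⟩)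
      fun j hj hk => (h j hj.1 hk).imp fun x hx => ⟨hx.1, hx.2.1, Or.inl hx.2.2⟩
    exact ⟨S, hS, hw, sum_eq_pathLoss hS hw fun x hx => (hR x hx).2, fun x hx => (hR x hx).1⟩
  by_cases hbad : ∃ w, L w ≠ 0 ∧ 0 < ρ w
  · obtain ⟨w₀, hw₀, hmax⟩ := Finset.exists_max_image
      (Finset.univ.filter fun w => L w ≠ 0 ∧ 0 < ρ w) (pathLoss L) (by
        obtain ⟨w, hw⟩ := hbad; exact ⟨w, by simpa using hw⟩)
    simp only [Finset.mem_filter, Finset.mem_univ, true_and, and_imp] at hw₀ hmax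
    suffices h : _ by
      obtain ⟨S, hS, hw, h1, h2⟩ := fin w₀ hw₀.2 h
      exact ⟨S, w₀, hS, hw, h1, h2, fun w h h' => ⟨hw₀.1, hmax w h h'⟩⟩
    intro j hj _
    -- Suppose all kids of `j` with mass are lossy, and let `x = D.par j`. The mass left at `x` sits
    -- on its kids, which are costlier than `x`, so it is at most `ρ₀ x / 4`. The mass removed at
    -- `x` is at most that removed at the root, which `hinv` bounds by mass removed from sequences
    -- costlier than `x`, again at most `ρ₀ x / 4`. Together `ρ₀ x ≤ ρ₀ x / 2`, contradicting `0 <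
    -- ρ₀ x`.
    by_contra! hcon
    have hkid : ∀ w ∈ D.kids j, 0 < ρ w → L w ≠ 0 := fun w hw h => hcon w hw h
    have hlt : ∀ w ∈ D.kids j, 0 < ρ w → pathLoss L (D.par j) < pathLoss L w := by
      intro w hw h
      rw [pathLoss_kid hw]
      have := (hL.nonneg w).lt_of_ne' (hkid w hw h)
      linarith
    obtain ⟨w₁, hw₁, hw₁pos⟩ : ∃ w ∈ D.kids j, 0 < ρ w := by
      by_contra! h
      have := Finset.sum_nonpos h
      rw [hρ j] at this
      linarith
    have hlt₀ : pathLoss L (D.par j) < pathLoss L w₀ :=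
      (hlt w₁ hw₁ hw₁pos).trans_le (hmax w₁ (hkid w₁ hw₁ hw₁pos) hw₁pos)
    set x := D.par j with hx
    have hx0 : 0 < ρ₀ x := hj.trans_le (hle x)
    have hK : (0 : ℝ) < Fintype.card W := by exact_mod_cast Fintype.card_pos_iff.2 ⟨x⟩
    have bound : ∀ w, pathLoss L x < pathLoss L w → ρ₀ w ≤ ρ₀ x / (4 * Fintype.card W) := by
      intro w hw
      rw [le_div_iff₀ (by positivity)]
      linarith [hgap w x hw]
    have hsum : ∀ s : Finset W, (∀ w ∈ s, ρ w ≠ 0 → pathLoss L x < pathLoss L w) →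
        ∑ w ∈ s, ρ w ≤ ρ₀ x / 4 := by
      intro s hs
      calc ∑ w ∈ s, ρ w ≤ ∑ w ∈ s, ρ₀ x / (4 * Fintype.card W) := by
            refine Finset.sum_le_sum fun w hw => ?_
            by_cases h : ρ w = 0
            · rw [h]; positivity
            · exact (hle w).trans (bound w (hs w hw h))
        _ ≤ ∑ w : W, ρ₀ x / (4 * Fintype.card W) :=
            Finset.sum_le_sum_of_subset_of_nonneg (Finset.subset_univ s)
              fun _ _ _ => by positivity
        _ = ρ₀ x / 4 := by
            rw [Finset.sum_const, Finset.card_univ, nsmul_eq_mul]; field_simp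
    have h1 : ρ x ≤ ρ₀ x / 4 := by
      rw [hx, ← hρ j]
      exact hsum _ fun w hw h => hlt w hw ((hnn w).lt_of_ne' h)
    have h2 : ρ₀ x - ρ x ≤ ρ₀ D.root - ρ D.root :=
      (hρ₀.sub hρ).antitone (fun w => sub_nonneg.2 (hle w)) (D.root_le x)
    have h3 : ∑ w with L w ≠ 0 ∧ pathLoss L w₀ ≤ pathLoss L w, (ρ₀ w - ρ w) ≤ ρ₀ x / 4 := by
      calc _ ≤ ∑ w with L w ≠ 0 ∧ pathLoss L w₀ ≤ pathLoss L w, ρ₀ x / (4 * Fintype.card W) := by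
            refine Finset.sum_le_sum fun w hw => ?_
            have := bound w (hlt₀.trans_le (Finset.mem_filter.1 hw).2.2)
            linarith [hnn w]
        _ ≤ ∑ w : W, ρ₀ x / (4 * Fintype.card W) :=
            Finset.sum_le_sum_of_subset_of_nonneg (Finset.subset_univ _)
              fun _ _ _ => by positivity
        _ = ρ₀ x / 4 := by
            rw [Finset.sum_const, Finset.card_univ, nsmul_eq_mul]; field_simp
    have h4 := hinv w₀ hw₀.1 hw₀.2 fun w h h' => hmax w h h'
    linarith
  · push Not at hbad
    suffices h : _ by
      obtain ⟨S, hS, hw, h1, h2⟩ := fin D.root hpos h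
      exact ⟨S, D.root, hS, hw, h1, h2, fun w h h' => absurd h' (hbad w h).not_gt⟩
    intro j hj _
    by_contra! hcon
    have : ∑ w ∈ D.kids j, ρ w ≤ 0 := Finset.sum_nonpos fun w hw => by
      by_contra! h
      exact (hbad w (hcon w hw h)).not_gt h
    rw [hρ j] at this
    linarith

variable {P : Type*} [Fintype P]

/-- A flow in which sequences of larger loss are much less likely is a mixture of pure strategies
that have no loss off one of their sequences. -/
theorem exists_decomposition [DecidableEq W] (hL : D.IsLoss L) {act : P → Finset W}
    (hsurj : ∀ S, D.IsPure S → ∃ p, act p = S) {ρ₀ : W → ℝ} (hρ₀ : D.IsFlow ρ₀)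
    (hnn : ∀ w, 0 ≤ ρ₀ w)
    (hgap : ∀ w x, pathLoss L x < pathLoss L w → 4 * Fintype.card W * ρ₀ w ≤ ρ₀ x) :
    ∃ c : P → ℝ, (∀ p, 0 ≤ c p) ∧
      (∀ p, c p ≠ 0 → ∃ w ∈ act p, ∑ x ∈ act p, L x = pathLoss L w) ∧
      ∀ w, ∑ p, c p * (if w ∈ act p then 1 else 0) = ρ₀ w := by
  have := Classical.decEq P
  -- Induction on the number of sequences with remaining mass. The last hypothesis is the invariant
  -- behind the peeling: while a costliest lossy `w₀` has mass left, all mass removed at the root is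
  -- accounted for by mass removed from lossy sequences at least as costly as `w₀`.
  suffices H : ∀ (n : ℕ) (ρ : W → ℝ), (Finset.univ.filter fun w => ρ w ≠ 0).card ≤ n →
      D.IsFlow ρ → (∀ w, 0 ≤ ρ w) → (∀ w, ρ w ≤ ρ₀ w) →
      (∀ w₀, L w₀ ≠ 0 → 0 < ρ w₀ → (∀ w, L w ≠ 0 → 0 < ρ w → pathLoss L w ≤ pathLoss L w₀) →
        ρ₀ D.root - ρ D.root ≤
          ∑ w with L w ≠ 0 ∧ pathLoss L w₀ ≤ pathLoss L w, (ρ₀ w - ρ w)) →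
      ∃ c : P → ℝ, (∀ p, 0 ≤ c p) ∧
        (∀ p, c p ≠ 0 → ∃ w ∈ act p, ∑ x ∈ act p, L x = pathLoss L w) ∧
        ∀ w, ∑ p, c p * (if w ∈ act p then 1 else 0) = ρ w from
    H _ ρ₀ le_rfl hρ₀ hnn (fun _ => le_rfl) (by simp)
  intro n
  induction n with
  | zero =>
    intro ρ hn _ _ _ _
    refine ⟨0, by simp, by simp, fun w => ?_⟩
    have := Finset.card_eq_zero.1 (Nat.le_zero.1 hn)
    have hw : w ∉ Finset.univ.filter fun w => ρ w ≠ 0 := by simp [this]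
    simpa [eq_comm] using hw
  | succ n ih =>
    intro ρ hn hρ hnn' hle hinv
    by_cases hr : ρ D.root = 0
    · refine ⟨0, by simp, by simp, fun w => ?_⟩
      have := hρ.antitone hnn' (D.root_le w)
      rw [hr] at this
      simp [le_antisymm this (hnn' w)]
    obtain ⟨S, w₀, hS, hw₀, hsum, hpos, hmax⟩ :=
      exists_peel hL hρ₀ hρ hnn' hle hgap hinv ((hnn' _).lt_of_ne' hr)
    -- Removing the least mass on `S` keeps `ρ` nonnegative and exhausts `y`, so the support
    -- shrinks.
    obtain ⟨y, hyS, hy⟩ := Finset.exists_min_image S ρ ⟨w₀, hw₀⟩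
    set m := ρ y
    have hm : 0 < m := hpos y hyS
    obtain ⟨q, hq⟩ := hsurj S hS
    have hle' : ∀ w, ρ w - m * (if w ∈ S then 1 else 0) ≤ ρ w := fun w => by
      split_ifs <;> linarith
    refine Exists.elim (ih (fun w => ρ w - m * (if w ∈ S then 1 else 0)) ?_
      (hρ.sub (hS.isFlow.smul m)) ?_ (fun w => (hle' w).trans (hle w)) ?_)
      fun c ⟨hc0, hc1, hc2⟩ => ?_
    rotate_left 3
    · refine ⟨fun p => c p + if p = q then m else 0, fun p => ?_, fun p hp => ?_, fun w => ?_⟩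
      · have := hc0 p
        dsimp only
        split_ifs <;> linarith
      · by_cases h : p = q
        · subst h
          exact ⟨w₀, hq ▸ hw₀, hq ▸ hsum⟩
        · exact hc1 p (by simpa [h] using hp)
      · simp only [add_mul, Finset.sum_add_distrib, hc2]
        have : ∑ p, (if p = q then m else 0) * (if w ∈ act p then (1 : ℝ) else 0) =
            m * (if w ∈ S then 1 else 0) := by
          rw [Finset.sum_eq_single_of_mem q (Finset.mem_univ q) fun p _ h => by simp [h], hq]
          simp
        rw [this]; ring
    · have : (Finset.univ.filter fun w => ρ w - m * (if w ∈ S then 1 else 0) ≠ 0) ⊂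
          Finset.univ.filter fun w => ρ w ≠ 0 := by
        refine Finset.ssubset_iff_subset_ne.2 ⟨fun w hw => ?_, fun h => ?_⟩
        · simp only [Finset.mem_filter, Finset.mem_univ, true_and] at hw ⊢
          intro h
          by_cases hwS : w ∈ S
          · exact (hpos w hwS).ne' h
          · simp [hwS, h] at hw
        · have : y ∈ Finset.univ.filter fun w => ρ w ≠ 0 := by simpa using hm.ne'
          rw [← h] at this
          simp [hyS, m] at this
      have := Finset.card_lt_card this
      omega
    · intro w
      split_ifs with h
      · linarith [hy w h]
      · linarith [hnn' w]
    -- The root and `w₀` both lose `m`, and `w₀` is lossy because `w₁` still has mass. Passing from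
    -- `w₀` to the no costlier `w₁` only enlarges the index set.
    · intro w₁ hL₁ hp₁ _
      have hpos₁ := hp₁.trans_le (hle' w₁)
      obtain ⟨hL₀, hle₁⟩ := hmax w₁ hL₁ hpos₁
      have h1 := hinv w₀ hL₀ (hpos _ hw₀) fun w h h' => (hmax w h h').2
      have h2 : ∑ w with L w ≠ 0 ∧ pathLoss L w₀ ≤ pathLoss L w, (ρ₀ w - ρ w) + m ≤
          ∑ w with L w ≠ 0 ∧ pathLoss L w₀ ≤ pathLoss L w,
            (ρ₀ w - (ρ w - m * (if w ∈ S then 1 else 0))) := by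
        have : ∀ w, ρ₀ w - (ρ w - m * (if w ∈ S then 1 else 0)) =
            (ρ₀ w - ρ w) + m * (if w ∈ S then 1 else 0) := fun w => by ring
        simp only [this, Finset.sum_add_distrib]
        gcongr
        refine le_trans (by simp [hw₀]) (Finset.single_le_sum (a := w₀) (fun w _ => ?_) ?_)
        · positivity
        · simp [hL₀]
      have h3 : ∑ w with L w ≠ 0 ∧ pathLoss L w₀ ≤ pathLoss L w,
            (ρ₀ w - (ρ w - m * (if w ∈ S then 1 else 0))) ≤
          ∑ w with L w ≠ 0 ∧ pathLoss L w₁ ≤ pathLoss L w,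
            (ρ₀ w - (ρ w - m * (if w ∈ S then 1 else 0))) := by
        refine Finset.sum_le_sum_of_subset_of_nonneg (fun w hw => ?_) fun w _ _ => ?_
        · simp only [Finset.mem_filter, Finset.mem_univ, true_and] at hw ⊢
          exact ⟨hw.1, hle₁.trans hw.2⟩
        · linarith [hle' w, hle w]
      simp only [hS.root_mem, if_true]
      linarith

/-! ### Transferring properness between strategies and sequences -/

/-- If more costly pure strategies are less likely, then so are more costly sequences. -/
theorem le_of_forall_pure_le [DecidableEq W] (hL : D.IsLoss L) {act : P → Finset W}
    (hact : ∀ p, D.IsPure (act p)) (hsurj : ∀ S, D.IsPure S → ∃ p, act p = S)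
    {τ : P → ℝ} {ε : ℝ} (hε : 0 ≤ ε) (hτ : ∀ p, 0 ≤ τ p)
    (hproper : ∀ p p', ∑ x ∈ act p', L x < ∑ x ∈ act p, L x → τ p ≤ ε * τ p')
    {w x : W} (hwx : pathLoss L x < pathLoss L w) :
    ∑ p, (if w ∈ act p then 1 else 0) * τ p ≤
      Fintype.card P * ε * ∑ p, (if x ∈ act p then 1 else 0) * τ p := by
  -- A cheapest strategy playing `x` is strictly cheaper than every strategy playing `w`, so it
  -- alone bounds each term.
  obtain ⟨S, hS, hxS, hsum⟩ := hL.exists_isPure_sum_eq x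
  obtain ⟨q, rfl⟩ := hsurj S hS
  have h1 : τ q ≤ ∑ p, (if x ∈ act p then 1 else 0) * τ p := by
    refine le_trans (by simp [hxS]) (Finset.single_le_sum (a := q) (fun p _ => ?_) (Finset.mem_univ q))
    exact mul_nonneg (by split_ifs <;> norm_num) (hτ p)
  calc ∑ p, (if w ∈ act p then 1 else 0) * τ p ≤ ∑ p : P, ε * τ q := by
        refine Finset.sum_le_sum fun p _ => ?_
        split_ifs with h
        · rw [one_mul]
          refine hproper p q ?_
          rw [hsum]
          exact hwx.trans_le (hL.pathLoss_le_sum (hact p) h)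
        · rw [zero_mul]; exact mul_nonneg hε (hτ q)
    _ = Fintype.card P * ε * τ q := by simp [mul_assoc]
    _ ≤ _ := by gcongr

/-- Weights of the pure strategies that increase with their payoff and are dominated by the
probabilities of the sequences they play. -/
theorem exists_small_weights {L : W → ℝ} (hL : D.IsLoss L) {act : P → Finset W}
    (hact : ∀ p, D.IsPure (act p)) {γ : W → ℝ} (hγpos : ∀ w, 0 < γ w)
    {ε κ δ : ℝ} (hκ0 : 0 < κ) (hκ1 : κ ≤ 1) (hκε : κ ≤ ε) (hδ : δ ≤ ε * κ ^ Fintype.card P)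
    (hgap : ∀ w x, pathLoss L x < pathLoss L w → γ w ≤ δ * γ x) :
    ∃ c : P → ℝ, (∀ p, 0 < c p) ∧ (∀ p, ∀ w ∈ act p, c p ≤ κ * γ w) ∧
      (∀ p p', ∑ x ∈ act p', L x < ∑ x ∈ act p, L x → c p ≤ ε * c p') ∧
      ∀ p w, ∑ x ∈ act p, L x < pathLoss L w → γ w ≤ ε * c p := by
  let loss : P → ℝ := fun p => ∑ x ∈ act p, L x
  have hloss : ∀ p, 0 ≤ loss p := fun p => Finset.sum_nonneg fun x _ => hL.nonneg x
  have hex : ∀ p, ∃ x, pathLoss L x ≤ loss p ∧ ∀ w, pathLoss L w ≤ loss p → γ x ≤ γ w := by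
    intro p
    obtain ⟨x, hx, h⟩ := Finset.exists_min_image
      (Finset.univ.filter fun x => pathLoss L x ≤ loss p) γ
      ⟨D.root, by simpa [pathLoss_root hL] using hloss p⟩
    exact ⟨x, (Finset.mem_filter.1 hx).2, fun w hw => h w (by simpa using hw)⟩
  -- `y p` is the rarest sequence no costlier than `p`. All sequences played by `p` compete here,
  -- and `γ (y p)` can only drop as the cost of `p` grows.
  choose y hy hmin using hex
  -- The cost rank: each strict increase in cost gains a factor `κ` in `κ ^ (r p + 1)`. The extra
  -- `1` supplies the factor `κ` at rank `0`, and `r p + 1 ≤ Fintype.card P` matches the exponent in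
  -- `hδ`.
  let r : P → ℕ := fun p => (Finset.univ.filter fun q => loss q < loss p).card
  have hr : ∀ p p', loss p' < loss p → r p' < r p := by
    intro p p' h
    refine Finset.card_lt_card (Finset.ssubset_iff_of_subset (fun q hq => ?_) |>.2 ⟨p', ?_⟩)
    · simp only [Finset.mem_filter, Finset.mem_univ, true_and] at hq ⊢
      exact hq.trans h
    · simp [h]
  have hrn : ∀ p, r p + 1 ≤ Fintype.card P := by
    intro p
    rw [Nat.succ_le_iff, ← Finset.card_univ]
    exact Finset.card_lt_card (Finset.ssubset_iff_of_subset (Finset.subset_univ _) |>.2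
      ⟨p, Finset.mem_univ p, by simp⟩)
  refine ⟨fun p => κ ^ (r p + 1) * γ (y p), fun p => mul_pos (by positivity) (hγpos _),
    fun p w hw => ?_, fun p p' h => ?_, fun p w h => ?_⟩
  · have h1 := hmin p w (hL.pathLoss_le_sum (hact p) hw)
    have h2 : κ ^ (r p + 1) ≤ κ := pow_le_of_le_one hκ0.le hκ1 (by simp)
    exact mul_le_mul h2 h1 (hγpos _).le hκ0.le
  · have h1 := hmin p (y p') ((hy p').trans (le_of_lt h))
    have h2 : κ ^ (r p + 1) ≤ κ * κ ^ (r p' + 1) := by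
      rw [← pow_succ']
      exact pow_le_pow_of_le_one hκ0.le hκ1 (Nat.succ_le_succ (hr p p' h))
    calc κ ^ (r p + 1) * γ (y p) ≤ κ * κ ^ (r p' + 1) * γ (y p') :=
          mul_le_mul h2 h1 (hγpos _).le (by positivity)
      _ ≤ ε * κ ^ (r p' + 1) * γ (y p') := by
          have := (hγpos (y p')).le
          gcongr
      _ = ε * (κ ^ (r p' + 1) * γ (y p')) := by ring
  · have h1 := hgap w (y p) ((hy p).trans_lt h)
    have h2 : δ ≤ ε * κ ^ (r p + 1) := hδ.trans <|
      mul_le_mul_of_nonneg_left (pow_le_pow_of_le_one hκ0.le hκ1 (hrn p)) (hκ0.le.trans hκε)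
    refine h1.trans ?_
    rw [← mul_assoc]
    exact mul_le_mul_of_nonneg_right h2 (hγpos _).le

/-- A realization plan that is close to the one induced by `σ` and in which more costly sequences
are much less likely is induced by a mixed strategy that is close to `σ` and in which more costly
pure strategies are much less likely. -/
theorem exists_mixed [DecidableEq W] {act : P → Finset W}
    (hact : ∀ p, D.IsPure (act p)) (hsurj : ∀ S, D.IsPure S → ∃ p, act p = S)
    {σ : P → ℝ} (hσ : ∀ p, 0 ≤ σ p) (hσ1 : ∑ p, σ p = 1) {ε : ℝ} (hε : 0 < ε) :
    ∃ δ > 0, ∀ γ L : W → ℝ, D.IsLoss L → D.IsFlow γ → γ D.root = 1 → (∀ w, 0 < γ w) →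
      (∀ w, |γ w - ∑ p, (if w ∈ act p then 1 else 0) * σ p| ≤ δ) →
      (∀ w x, pathLoss L x < pathLoss L w → γ w ≤ δ * γ x) →
      ∃ τ : P → ℝ, (∀ p, 0 < τ p) ∧ (∀ w, ∑ p, (if w ∈ act p then 1 else 0) * τ p = γ w) ∧
        (∀ p, |τ p - σ p| < ε) ∧
        ∀ p p', ∑ x ∈ act p', L x < ∑ x ∈ act p, L x → τ p ≤ ε * τ p' := by
  set γ' : W → ℝ := fun w => ∑ p, (if w ∈ act p then 1 else 0) * σ p with hγ'
  have hind : ∀ w p, (0 : ℝ) ≤ if w ∈ act p then 1 else 0 := fun w p => by split_ifs <;> norm_num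
  have hγ'0 : ∀ w, 0 ≤ γ' w := fun w => Finset.sum_nonneg fun p _ => mul_nonneg (hind w p) (hσ p)
  have hγ'flow : D.IsFlow γ' := IsFlow.sum _ fun p _ j => by
    rw [← Finset.sum_mul, (hact p).isFlow j]
  have hroot : ∀ c : P → ℝ, ∑ p, (if D.root ∈ act p then 1 else 0) * c p = ∑ p, c p :=
    fun c => Finset.sum_congr rfl fun p _ => by rw [if_pos (hact p).root_mem, one_mul]
  have hle_ind : ∀ (c : P → ℝ) w p, (∀ p, 0 ≤ c p) → w ∈ act p →
      c p ≤ ∑ p, (if w ∈ act p then 1 else 0) * c p := by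
    intro c w p hc hw
    refine le_trans (by simp [hw]) (Finset.single_le_sum (a := p) (fun q _ => ?_) (Finset.mem_univ p))
    exact mul_nonneg (hind w q) (hc q)
  -- The least positive value of `γ'` turns additive closeness into a multiplicative bound wherever
  -- `γ'` is positive.
  obtain ⟨μ, hμ, hμle⟩ : ∃ μ > 0, ∀ w, 0 < γ' w → μ ≤ γ' w := by
    obtain ⟨w, hw, h⟩ := Finset.exists_min_image (Finset.univ.filter fun w => 0 < γ' w) γ'
      ⟨D.root, Finset.mem_filter.2 ⟨Finset.mem_univ _, by
        rw [hγ']; dsimp only; rw [hroot, hσ1]; norm_num⟩⟩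
    exact ⟨γ' w, (Finset.mem_filter.1 hw).2, fun x hx => h x (by simpa using hx)⟩
  have hn : (0 : ℝ) < Fintype.card P := by
    have : Nonempty P := by
      by_contra h
      rw [not_nonempty_iff] at h
      simp at hσ1
    exact_mod_cast Fintype.card_pos
  have hK : (0 : ℝ) < Fintype.card W := by exact_mod_cast Fintype.card_pos_iff.2 ⟨D.root⟩
  obtain ⟨η, hη0, hηε, hη1⟩ : ∃ η : ℝ, 0 < η ∧ η < ε ∧ η ≤ 1 / 2 :=
    ⟨min (ε / 2) (1 / 2), by positivity, (min_le_left _ _).trans_lt (by linarith), min_le_right _ _⟩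
  obtain ⟨κ, hκ0, hκε, hκ1, hκη⟩ :
      ∃ κ : ℝ, 0 < κ ∧ κ ≤ ε ∧ κ ≤ 1 ∧ κ ≤ η / (4 * Fintype.card P) :=
    ⟨min ε (min 1 (η / (4 * Fintype.card P))), by positivity, min_le_left _ _,
      (min_le_right _ _).trans (min_le_left _ _), (min_le_right _ _).trans (min_le_right _ _)⟩
  -- Here `η` is the weight taken from `σ`, and `κ` makes `c` use at most `η / 4 * γ w`. The bounds
  -- on `δ` serve closeness to `γ'`, the gap required by `exists_decomposition`, and
  -- `exists_small_weights`.
  obtain ⟨δ, hδ0, hδμ, hδη, hδκ⟩ : ∃ δ : ℝ, 0 < δ ∧ δ ≤ η / 2 * μ ∧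
      δ ≤ η / (16 * Fintype.card W) ∧ δ ≤ ε * κ ^ Fintype.card P :=
    ⟨min (η / 2 * μ) (min (η / (16 * Fintype.card W)) (ε * κ ^ Fintype.card P)), by positivity,
      min_le_left _ _, (min_le_right _ _).trans (min_le_left _ _),
      (min_le_right _ _).trans (min_le_right _ _)⟩
  refine ⟨δ, hδ0, fun γ L hL hγ hγ1 hγpos hclose hgap => ?_⟩
  have hclose' : ∀ w, 0 < γ' w → (1 - η / 2) * γ' w ≤ γ w := by
    intro w hw
    have h1 := (abs_le.1 (hclose w)).1
    have h2 : η / 2 * μ ≤ η / 2 * γ' w := by gcongr; exact hμle w hw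
    change -δ ≤ γ w - γ' w at h1
    linarith
  -- This rests on `(1 - η / 2) ^ 2 ≥ 1 - η`.
  have hfirst : ∀ w, η / 2 * γ w ≤ γ w - (1 - η) * γ' w := by
    intro w
    rcases (hγ'0 w).eq_or_lt with h | h
    · rw [← h]; nlinarith [hγpos w]
    · have h1 := mul_le_mul_of_nonneg_left (hclose' w h) (by linarith : (0 : ℝ) ≤ 1 - η / 2)
      nlinarith [mul_nonneg (sq_nonneg η) (hγ'0 w)]
  -- Comparison with the root gives a lossy sequence mass at most `δ`, too little for one that `σ`
  -- plays with positive probability.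
  have hsupp : ∀ p, 0 < σ p → ∑ x ∈ act p, L x = 0 := by
    intro p hp
    refine Finset.sum_eq_zero fun w hw => ?_
    by_contra hne
    have hw' : 0 < γ' w := hp.trans_le (hle_ind σ w p hσ hw)
    have h1 : pathLoss L D.root < pathLoss L w := by
      rw [pathLoss_root hL]
      exact ((hL.nonneg w).lt_of_ne' hne).trans_le (hL.le_pathLoss w)
    have h2 := hgap w _ h1
    rw [hγ1, mul_one] at h2
    have h3 := hclose' w hw'
    have h4 : η / 2 * μ ≤ η / 2 * γ' w := by gcongr; exact hμle w hw'
    nlinarith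
  obtain ⟨c, hc0, hcle, hcmono, hcgap⟩ :=
    exists_small_weights hL hact hγpos hκ0 hκ1 hκε hδκ hgap
  have hcsum : ∀ w, ∑ p, (if w ∈ act p then 1 else 0) * c p ≤ η / 4 * γ w := by
    intro w
    calc ∑ p, (if w ∈ act p then 1 else 0) * c p ≤ ∑ p : P, κ * γ w := by
          refine Finset.sum_le_sum fun p _ => ?_
          split_ifs with h
          · rw [one_mul]; exact hcle p w h
          · rw [zero_mul]; exact mul_nonneg hκ0.le (hγpos w).le
      _ = Fintype.card P * κ * γ w := by simp [mul_assoc]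
      _ ≤ η / 4 * γ w := by
          refine mul_le_mul_of_nonneg_right ?_ (hγpos w).le
          rw [le_div_iff₀ (by positivity)] at hκη
          linarith
  have hcflow : D.IsFlow fun w => ∑ p, (if w ∈ act p then 1 else 0) * c p :=
    IsFlow.sum _ fun p _ j => by rw [← Finset.sum_mul, (hact p).isFlow j]
  have hc0' : ∀ w, 0 ≤ ∑ p, (if w ∈ act p then 1 else 0) * c p := fun w =>
    Finset.sum_nonneg fun p _ => mul_nonneg (hind w p) (hc0 p).le
  -- The remainder lies between `η / 4 * γ` and `γ`, so it inherits a gap from `γ`; `δ ≤ η / (16 *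
  -- Fintype.card W)` yields the factor `4 * Fintype.card W`.
  obtain ⟨d, hd0, hdext, hdsum⟩ := exists_decomposition hL hsurj
    (ρ₀ := fun w => γ w - (1 - η) * γ' w - ∑ p, (if w ∈ act p then 1 else 0) * c p)
    ((hγ.sub (hγ'flow.smul _)).sub hcflow)
    (fun w => by
      have := hfirst w
      have := hcsum w
      nlinarith [mul_pos hη0 (hγpos w)])
    (fun w x hwx => by
      have h1 := hfirst x
      have h2 := hcsum x
      have h3 := hc0' w
      have h4 := mul_nonneg (by linarith : 0 ≤ 1 - η) (hγ'0 w)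
      have h5 := hgap w x hwx
      have h6 : 4 * Fintype.card W * γ w ≤ η / 4 * γ x := by
        rw [le_div_iff₀ (by positivity)] at hδη
        calc 4 * Fintype.card W * γ w ≤ 4 * Fintype.card W * (δ * γ x) := by gcongr
          _ = (δ * (16 * Fintype.card W)) / 4 * γ x := by ring
          _ ≤ η / 4 * γ x := by
            have := (hγpos x).le
            gcongr
      have h7 : 4 * Fintype.card W *
          (γ w - (1 - η) * γ' w - ∑ p, (if w ∈ act p then 1 else 0) * c p) ≤
          4 * Fintype.card W * γ w := by
        gcongr
        linarith
      linarith)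
  set τ : P → ℝ := fun p => (1 - η) * σ p + c p + d p with hτ
  have hτc : ∀ p, c p ≤ τ p := fun p => by
    have := mul_nonneg (by linarith : 0 ≤ 1 - η) (hσ p)
    have := hd0 p
    simp only [hτ]; linarith
  have hτ0 : ∀ p, 0 < τ p := fun p => (hc0 p).trans_le (hτc p)
  have hτsum : ∀ w, ∑ p, (if w ∈ act p then 1 else 0) * τ p = γ w := by
    intro w
    have h1 := hdsum w
    simp only [hτ, mul_add, Finset.sum_add_distrib]
    have h2 : ∑ p, (if w ∈ act p then 1 else 0) * d p =
        ∑ p, d p * (if w ∈ act p then 1 else 0) :=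
      Finset.sum_congr rfl fun p _ => mul_comm _ _
    have h3 : ∑ p, (if w ∈ act p then 1 else 0) * ((1 - η) * σ p) = (1 - η) * γ' w := by
      rw [hγ', Finset.mul_sum]
      exact Finset.sum_congr rfl fun p _ => by ring
    rw [h2, h1, h3]; ring
  refine ⟨τ, hτ0, hτsum, fun p => ?_, fun p p' h => ?_⟩
  · have h1 : ∑ p, (c p + d p) = η := by
      have := hτsum D.root
      rw [hroot, hγ1] at this
      simp only [hτ, Finset.sum_add_distrib, ← Finset.mul_sum, hσ1] at this
      rw [Finset.sum_add_distrib]; linarith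
    have h2 : c p + d p ≤ η := h1 ▸ Finset.single_le_sum (f := fun p => c p + d p)
      (fun p _ => add_nonneg (hc0 p).le (hd0 p)) (Finset.mem_univ p)
    have h3 : σ p ≤ 1 := hσ1 ▸ Finset.single_le_sum (fun p _ => hσ p) (Finset.mem_univ p)
    have h4 := hσ p
    have h5 := (hc0 p).le
    have h6 := hd0 p
    refine lt_of_le_of_lt (abs_le.2 ⟨?_, ?_⟩) hηε <;> simp only [hτ] <;> nlinarith
  -- A strategy with a cheaper competitor has positive cost, hence lies outside the support of `σ`.
  · have hσp : σ p = 0 := by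
      by_contra hne
      have h1 := hsupp p ((hσ p).lt_of_ne' hne)
      have h2 : 0 ≤ ∑ x ∈ act p', L x := Finset.sum_nonneg fun x _ => hL.nonneg x
      linarith
    have hmul : ε * c p' ≤ ε * τ p' := mul_le_mul_of_nonneg_left (hτc p') hε.le
    by_cases hdp : d p = 0
    · have : τ p = c p := by simp [hτ, hσp, hdp]
      rw [this]
      exact (hcmono p p' h).trans hmul
    · obtain ⟨w, hw, hlw⟩ := hdext p hdp
      have h1 : τ p ≤ γ w := hτsum w ▸ hle_ind τ w p (fun p => (hτ0 p).le) hw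
      exact h1.trans ((hcgap p' w (hlw ▸ h)).trans hmul)

end DecisionTree

/-! ### Histories, records and sequences of a game -/

namespace ExtensiveGame

variable {N α : Type*} [DecidableEq N] [DecidableEq α] {G : ExtensiveGame N α}

theorem mem_nodes {j : Option N} {h : List α} :
    h ∈ G.nodes j ↔ h ∈ G.H ∧ (G.actions h).Nonempty ∧ G.mover h = j := by
  simp [nodes]

theorem mem_nodes_of_cons_mem {a : α} {h : List α} (hh : a :: h ∈ G.H) :
    h ∈ G.nodes (G.mover h) :=
  mem_nodes.2 ⟨G.tail_mem a h hh, ⟨a, G.mem_actions.2 hh⟩, rfl⟩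

theorem mem_H_of_suffix {h' h : List α} (hs : h' <:+ h) (hh : h ∈ G.H) : h' ∈ G.H := by
  induction h with
  | nil => rwa [List.suffix_nil.1 hs]
  | cons a h ih =>
    rcases List.suffix_cons_iff.1 hs with rfl | hs
    · exact hh
    · exact ih hs (G.tail_mem a h hh)

theorem seqSet_nil (j : Option N) : G.seqSet j [] = ∅ := rfl

theorem seqSet_cons_of_eq {j : Option N} {h : List α} (hj : G.mover h = j) (a : α) :
    G.seqSet j (a :: h) = insert (G.cell j h, a) (G.seqSet j h) := by
  simp [seqSet, record, hj]

theorem seqSet_cons_of_ne {j : Option N} {h : List α} (hj : G.mover h ≠ j) (a : α) :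
    G.seqSet j (a :: h) = G.seqSet j h := by
  simp [seqSet, record, hj]

theorem record_suffix (j : Option N) {h' h : List α} (hs : h' <:+ h) :
    G.record j h' <:+ G.record j h := by
  induction h with
  | nil => rw [List.suffix_nil.1 hs]
  | cons a h ih =>
    rcases List.suffix_cons_iff.1 hs with rfl | hs
    · exact List.suffix_rfl
    · refine (ih hs).trans ?_
      rw [record]
      split_ifs
      · exact List.suffix_cons _ _
      · exact List.suffix_rfl

theorem seqSet_subset_of_suffix (j : Option N) {h' h : List α} (hs : h' <:+ h) :
    G.seqSet j h' ⊆ G.seqSet j h := fun _ hm =>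
  List.mem_toFinset.2 ((record_suffix j hs).subset (List.mem_toFinset.1 hm))

theorem exists_suffix_of_mem_seqSet {j : Option N} {h : List α} {m : Finset (List α) × α}
    (hm : m ∈ G.seqSet j h) :
    ∃ h', m.2 :: h' <:+ h ∧ G.mover h' = j ∧ m.1 = G.cell j h' := by
  induction h with
  | nil => simp [seqSet_nil] at hm
  | cons a h ih =>
    by_cases hj : G.mover h = j
    · rw [seqSet_cons_of_eq hj, Finset.mem_insert] at hm
      rcases hm with rfl | hm
      · exact ⟨h, List.suffix_rfl, hj, rfl⟩
      · obtain ⟨h', hs, h1⟩ := ih hm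
        exact ⟨h', hs.trans (List.suffix_cons _ _), h1⟩
    · rw [seqSet_cons_of_ne hj] at hm
      obtain ⟨h', hs, h1⟩ := ih hm
      exact ⟨h', hs.trans (List.suffix_cons _ _), h1⟩

theorem exists_cons_of_seqSet_nonempty {j : Option N} {h : List α} (hh : h ∈ G.H)
    (hne : G.seqSet j h ≠ ∅) :
    ∃ a h', a :: h' ∈ G.H ∧ G.mover h' = j ∧ G.seqSet j h = G.seqSet j (a :: h') := by
  induction h with
  | nil => exact absurd (seqSet_nil j) hne
  | cons a h ih =>
    by_cases hj : G.mover h = j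
    · exact ⟨a, h, hh, hj, rfl⟩
    · rw [seqSet_cons_of_ne hj] at hne ⊢
      exact ih (G.tail_mem a h hh) hne

/-! ### Consequences of perfect recall -/

theorem cell_mem_parts {i : N} {h : List α} (hh : h ∈ G.nodes (some i)) :
    G.cell (some i) h ∈ (G.info i).parts := (G.info i).part_mem.2 hh

theorem mem_cell_self {i : N} {h : List α} (hh : h ∈ G.nodes (some i)) :
    h ∈ G.cell (some i) h := (G.info i).mem_part_self.2 hh

theorem mem_nodes_of_mem_part {i : N} {I : Finset (List α)} (hI : I ∈ (G.info i).parts)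
    {h : List α} (hh : h ∈ I) : h ∈ G.nodes (some i) := (G.info i).subset hI hh

theorem cell_eq_of_mem {i : N} {I : Finset (List α)} (hI : I ∈ (G.info i).parts)
    {h : List α} (hh : h ∈ I) : G.cell (some i) h = I := (G.info i).part_eq_of_mem hI hh

theorem actions_eq_of_cell_eq {i : N} {h h' : List α} (hh : h ∈ G.nodes (some i))
    (hh' : h' ∈ G.nodes (some i)) (hc : G.cell (some i) h = G.cell (some i) h') :
    G.actions h = G.actions h' :=
  G.actions_eq i _ (cell_mem_parts hh) h (mem_cell_self hh) h' (hc ▸ mem_cell_self hh')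

theorem record_eq_of_cell_eq (hG : G.PerfectRecall) {i : N} {h h' : List α}
    (hh : h ∈ G.nodes (some i)) (hh' : h' ∈ G.nodes (some i))
    (hc : G.cell (some i) h = G.cell (some i) h') :
    G.record (some i) h = G.record (some i) h' :=
  hG i _ (cell_mem_parts hh) h (mem_cell_self hh) h' (hc ▸ mem_cell_self hh')

theorem seqSet_eq_of_cell_eq (hG : G.PerfectRecall) {i : N} {h h' : List α}
    (hh : h ∈ G.nodes (some i)) (hh' : h' ∈ G.nodes (some i))
    (hc : G.cell (some i) h = G.cell (some i) h') :
    G.seqSet (some i) h = G.seqSet (some i) h' := by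
  rw [seqSet, record_eq_of_cell_eq hG hh hh' hc, seqSet]

/-- An earlier visit to the same information set would have the same record, yet the later record
contains one more move. -/
theorem cell_notMem_seqSet (hG : G.PerfectRecall) {i : N} {h : List α}
    (hh : h ∈ G.nodes (some i)) (a : α) : (G.cell (some i) h, a) ∉ G.seqSet (some i) h := by
  intro hm
  obtain ⟨h', hs, hj, hc⟩ := exists_suffix_of_mem_seqSet hm
  have hH' := mem_H_of_suffix hs (mem_nodes.1 hh).1
  have hh' : h' ∈ G.nodes (some i) := hj ▸ mem_nodes_of_cons_mem hH'
  have h1 := (record_suffix (G := G) (some i) hs).length_le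
  rw [record, if_pos hj, record_eq_of_cell_eq hG hh hh' hc] at h1
  simp at h1

/-- The move may occur along `x` at another history of the cell, but perfect recall makes the
preceding sequence the same. -/
theorem seqSet_cons_subset_of_mem (hG : G.PerfectRecall) {i : N} {h x : List α} {a : α}
    (hh : h ∈ G.nodes (some i)) (hx : x ∈ G.H)
    (hm : (G.cell (some i) h, a) ∈ G.seqSet (some i) x) :
    G.seqSet (some i) (a :: h) ⊆ G.seqSet (some i) x := by
  obtain ⟨h', hs, hj, hc⟩ := exists_suffix_of_mem_seqSet hm
  have hH' := mem_H_of_suffix hs hx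
  have hh' : h' ∈ G.nodes (some i) := hj ▸ mem_nodes_of_cons_mem hH'
  dsimp only at hs hc
  have := seqSet_subset_of_suffix (G := G) (some i) hs
  rwa [seqSet_cons_of_eq hj, ← hc, ← seqSet_eq_of_cell_eq hG hh hh' hc,
    ← seqSet_cons_of_eq (mem_nodes.1 hh).2.2] at this

theorem Seq.exists_eq {j : Option N} (w : G.Seq j) : ∃ h ∈ G.H, w.1 = G.seqSet j h := by
  obtain ⟨h, hh, e⟩ := Finset.mem_image.1 w.2
  exact ⟨h, hh, e.symm⟩

/-! ### The decision tree of a player -/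

open Classical in
/-- The decision problem of player `i`. -/
noncomputable def tree (hG : G.PerfectRecall) (i : N) :
    DecisionTree (G.Seq (some i)) {I // I ∈ (G.info i).parts} where
  root := G.seqAt (some i) [] G.nil_mem
  par I := G.seqAt (some i) ((G.info i).nonempty_of_mem_parts I.2).choose
    (mem_nodes.1 (mem_nodes_of_mem_part I.2
      ((G.info i).nonempty_of_mem_parts I.2).choose_spec)).1
  kids I := Finset.univ.filter fun w =>
    ∃ h ∈ I.1, ∃ a ∈ G.actions h, w.1 = G.seqSet (some i) (a :: h)
  root_le w := Finset.empty_subset w.1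
  le_iff := by
    rintro I w hw x
    obtain ⟨h, hI, a, ha, hwa⟩ := (Finset.mem_filter.1 hw).2
    have hh := mem_nodes_of_mem_part I.2 hI
    have h0 := ((G.info i).nonempty_of_mem_parts I.2).choose_spec
    have hc : G.cell (some i) h = G.cell (some i) _ :=
      (cell_eq_of_mem I.2 hI).trans (cell_eq_of_mem I.2 h0).symm
    have hp := seqSet_eq_of_cell_eq hG hh (mem_nodes_of_mem_part I.2 h0) hc
    change x.1 ⊆ w.1 ↔ x = w ∨ x.1 ⊆ G.seqSet (some i) _
    rw [Subtype.ext_iff, ← hp, hwa, seqSet_cons_of_eq (mem_nodes.1 hh).2.2]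
    constructor
    · intro hx
      obtain ⟨y, hy, hxy⟩ := x.exists_eq
      -- With the last move `x` contains everything before it, by perfect recall; without it `x`
      -- lies in the parent.
      by_cases hm : (G.cell (some i) h, a) ∈ x.1
      · left
        refine hx.antisymm ?_
        rw [hxy] at hm ⊢
        rw [← seqSet_cons_of_eq (mem_nodes.1 hh).2.2]
        exact seqSet_cons_subset_of_mem hG hh hy hm
      · right
        exact (Finset.subset_insert_iff_of_notMem hm).1 hx
    · rintro (hx | hx)
      · exact hx.le
      · exact hx.trans (Finset.subset_insert _ _)
  not_le := by
    rintro I w hw hle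
    obtain ⟨h, hI, a, ha, hwa⟩ := (Finset.mem_filter.1 hw).2
    have hh := mem_nodes_of_mem_part I.2 hI
    have h0 := ((G.info i).nonempty_of_mem_parts I.2).choose_spec
    have hc : G.cell (some i) h = G.cell (some i) _ :=
      (cell_eq_of_mem I.2 hI).trans (cell_eq_of_mem I.2 h0).symm
    have hp := seqSet_eq_of_cell_eq hG hh (mem_nodes_of_mem_part I.2 h0) hc
    change w.1 ⊆ G.seqSet (some i) _ at hle
    rw [← hp, hwa, seqSet_cons_of_eq (mem_nodes.1 hh).2.2] at hle
    exact cell_notMem_seqSet hG hh a (hle (Finset.mem_insert_self _ _))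
  exists_kid := by
    intro w hw
    obtain ⟨h, hh, e⟩ := w.exists_eq
    obtain ⟨a, h', hH', hj, e'⟩ := exists_cons_of_seqSet_nonempty (j := some i) hh
      fun h0 => hw (Subtype.ext (e.trans h0))
    have hn : h' ∈ G.nodes (some i) := hj ▸ mem_nodes_of_cons_mem hH'
    exact ⟨⟨_, cell_mem_parts hn⟩, Finset.mem_filter.2 ⟨Finset.mem_univ _, h', mem_cell_self hn,
      a, G.mem_actions.2 hH', e.trans e'⟩⟩
  kids_unique := by
    intro I I' w hw hw'
    obtain ⟨h, hI, a, ha, hwa⟩ := (Finset.mem_filter.1 hw).2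
    obtain ⟨h', hI', a', ha', hwa'⟩ := (Finset.mem_filter.1 hw').2
    have hh := mem_nodes_of_mem_part I.2 hI
    have hh' := mem_nodes_of_mem_part I'.2 hI'
    have hm : (G.cell (some i) h, a) ∈ w.1 := by
      rw [hwa, seqSet_cons_of_eq (mem_nodes.1 hh).2.2]; exact Finset.mem_insert_self _ _
    have hm' : (G.cell (some i) h', a') ∈ w.1 := by
      rw [hwa', seqSet_cons_of_eq (mem_nodes.1 hh').2.2]; exact Finset.mem_insert_self _ _
    have hm2 := hm
    rw [hwa', seqSet_cons_of_eq (mem_nodes.1 hh').2.2, Finset.mem_insert] at hm2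
    rcases hm2 with e | hm2
    · refine Subtype.ext ?_
      rw [← cell_eq_of_mem I.2 hI, ← cell_eq_of_mem I'.2 hI']
      exact congrArg Prod.fst e
    -- Otherwise the move at `I` precedes `I'`, so all of `w` is contained in the sequence leading
    -- to `I'`, including the move at `I'` itself.
    · have := seqSet_cons_subset_of_mem hG hh (mem_nodes.1 hh').1 hm2
      rw [← hwa] at this
      exact absurd (this hm') (cell_notMem_seqSet hG hh' a')
  kids_nonempty := by
    intro I
    obtain ⟨h, hI⟩ := (G.info i).nonempty_of_mem_parts I.2
    obtain ⟨a, ha⟩ := (mem_nodes.1 (mem_nodes_of_mem_part I.2 hI)).2.1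
    exact ⟨G.seqAt (some i) (a :: h) (G.mem_actions.1 ha),
      Finset.mem_filter.2 ⟨Finset.mem_univ _, h, hI, a, ha, rfl⟩⟩

variable (hG : G.PerfectRecall) {i : N}

/-- Perfect recall makes the choice of a history in `tree` irrelevant. -/
theorem tree_par {I : {I // I ∈ (G.info i).parts}} {h : List α} (hI : h ∈ I.1) :
    ((tree hG i).par I).1 = G.seqSet (some i) h := by
  have h0 := ((G.info i).nonempty_of_mem_parts I.2).choose_spec
  exact seqSet_eq_of_cell_eq hG (mem_nodes_of_mem_part I.2 h0) (mem_nodes_of_mem_part I.2 hI)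
    ((cell_eq_of_mem I.2 h0).trans (cell_eq_of_mem I.2 hI).symm)

theorem mem_tree_kids {I : {I // I ∈ (G.info i).parts}} {h : List α} (hI : h ∈ I.1)
    {w : G.Seq (some i)} : w ∈ (tree hG i).kids I ↔
      ∃ a, ∃ ha : a ∈ G.actions h, w = G.seqAt (some i) (a :: h) (G.mem_actions.1 ha) := by
  have hh := mem_nodes_of_mem_part I.2 hI
  constructor
  · intro hw
    obtain ⟨h', hI', a, ha, e⟩ := (Finset.mem_filter.1 hw).2
    have hh' := mem_nodes_of_mem_part I.2 hI'
    have hc : G.cell (some i) h' = G.cell (some i) h :=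
      (cell_eq_of_mem I.2 hI').trans (cell_eq_of_mem I.2 hI).symm
    refine ⟨a, actions_eq_of_cell_eq hh' hh hc ▸ ha, Subtype.ext ?_⟩
    rw [e, seqSet_cons_of_eq (mem_nodes.1 hh').2.2, hc, seqSet_eq_of_cell_eq hG hh' hh hc,
      ← seqSet_cons_of_eq (mem_nodes.1 hh).2.2]
    rfl
  · rintro ⟨a, ha, rfl⟩
    exact Finset.mem_filter.2 ⟨Finset.mem_univ _, h, hI, a, ha, rfl⟩

theorem seqAt_cons_injective (hG : G.PerfectRecall) {i : N} {h : List α} (hh : h ∈ G.nodes (some i)) {a b : α}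
    (e : G.seqSet (some i) (a :: h) = G.seqSet (some i) (b :: h)) : a = b := by
  have hj := (mem_nodes.1 hh).2.2
  have : (G.cell (some i) h, a) ∈ G.seqSet (some i) (a :: h) := by
    rw [seqSet_cons_of_eq hj]; exact Finset.mem_insert_self _ _
  rw [e, seqSet_cons_of_eq hj, Finset.mem_insert] at this
  exact congrArg Prod.snd (this.resolve_right (cell_notMem_seqSet hG hh a))

theorem sum_tree_kids (f : G.Seq (some i) → ℝ) {I : {I // I ∈ (G.info i).parts}} {h : List α}
    (hI : h ∈ I.1) : ∑ w ∈ (tree hG i).kids I, f w =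
      ∑ a : {a // a ∈ G.actions h}, f (G.seqAt (some i) (a.1 :: h) (G.mem_actions.1 a.2)) := by
  symm
  refine Finset.sum_bij (fun a _ => G.seqAt (some i) (a.1 :: h) (G.mem_actions.1 a.2))
    (fun a _ => (mem_tree_kids hG hI).2 ⟨a.1, a.2, rfl⟩) (fun a _ b _ e => ?_) (fun w hw => ?_)
    fun _ _ => rfl
  · exact Subtype.ext (seqAt_cons_injective hG (mem_nodes_of_mem_part I.2 hI)
      (congrArg Subtype.val e))
  · obtain ⟨a, ha, e⟩ := (mem_tree_kids hG hI).1 hw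
    exact ⟨⟨a, ha⟩, Finset.mem_univ _, e.symm⟩

/-- All histories of an information set yield the same flow equation. -/
theorem mem_plans_iff {γ : G.Seq (some i) → ℝ} :
    γ ∈ G.plans i ↔ γ (tree hG i).root = 1 ∧ (∀ w, 0 ≤ γ w) ∧ (tree hG i).IsFlow γ := by
  refine and_congr Iff.rfl (and_congr Iff.rfl ⟨fun h I => ?_, fun h x hx => ?_⟩)
  · obtain ⟨x, hx⟩ := (G.info i).nonempty_of_mem_parts I.2
    rw [sum_tree_kids hG γ hx, h x (mem_nodes_of_mem_part I.2 hx)]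
    exact congrArg γ (Subtype.ext (tree_par hG hx).symm)
  · have := h ⟨_, cell_mem_parts hx⟩
    rw [sum_tree_kids hG γ (mem_cell_self hx)] at this
    rw [this]
    exact congrArg γ (Subtype.ext (tree_par hG (mem_cell_self hx)))

/-! ### Reduced pure strategies as sets of sequences -/

open Classical in
/-- The sequences that a pure strategy plays. -/
noncomputable def playedSeqs (s : G.Pure i) : Finset (G.Seq (some i)) :=
  Finset.univ.filter fun w => w.1 ⊆ s.1

theorem mem_playedSeqs {s : G.Pure i} {w : G.Seq (some i)} : w ∈ playedSeqs s ↔ w.1 ⊆ s.1 := by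
  simp [playedSeqs]

theorem mem_pureStrategies {s : Finset (Finset (List α) × α)} :
    s ∈ G.pureStrategies i ↔ G.IsPure i s := by
  simp only [pureStrategies, Finset.mem_filter, Finset.mem_powerset, and_iff_right_iff_imp]
  exact fun h => h.1

theorem mem_actions_of_mem_moves {h : List α} (hh : h ∈ G.nodes (some i)) {a : α}
    (hm : (G.cell (some i) h, a) ∈ G.moves i) : a ∈ G.actions h := by
  simp only [moves, Finset.mem_biUnion, Finset.mem_image] at hm
  obtain ⟨h', hh', b, hb, e⟩ := hm
  obtain ⟨e1, rfl⟩ := Prod.ext_iff.1 e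
  exact actions_eq_of_cell_eq hh' hh e1 ▸ hb

theorem isPure_playedSeqs (s : G.Pure i) : (tree hG i).IsPure (playedSeqs s) := by
  have hs := mem_pureStrategies.1 s.2
  refine ⟨mem_playedSeqs.2 (Finset.empty_subset _), fun I hI => ?_, fun I w hw hws => ?_⟩
  · obtain ⟨h, hh⟩ := (G.info i).nonempty_of_mem_parts I.2
    have hn := mem_nodes_of_mem_part I.2 hh
    have hj := (mem_nodes.1 hn).2.2
    rw [mem_playedSeqs, tree_par hG hh] at hI
    obtain ⟨a, ha, hu⟩ := (hs.2 h hn).1 hI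
    have haA := mem_actions_of_mem_moves hn (hs.1 ha)
    refine ⟨G.seqAt (some i) (a :: h) (G.mem_actions.1 haA),
      ⟨(mem_tree_kids hG hh).2 ⟨a, haA, rfl⟩, mem_playedSeqs.2 ?_⟩, ?_⟩
    · change G.seqSet (some i) (a :: h) ⊆ s.1
      rw [seqSet_cons_of_eq hj]
      exact Finset.insert_subset ha hI
    · rintro w ⟨hw, hws⟩
      obtain ⟨b, hb, rfl⟩ := (mem_tree_kids hG hh).1 hw
      obtain rfl : b = a := hu b (mem_playedSeqs.1 hws (by
        change _ ∈ G.seqSet (some i) (b :: h)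
        rw [seqSet_cons_of_eq hj]; exact Finset.mem_insert_self _ _))
      rfl
  · exact mem_playedSeqs.2 (le_trans ((tree hG i).par_lt hw).le (mem_playedSeqs.1 hws))

/-- The strategy is the union of the moves in the sequences of `A`; it is reduced since it contains
only moves that `A` reaches. -/
theorem exists_playedSeqs_eq {A : Finset (G.Seq (some i))} (hA : (tree hG i).IsPure A) :
    ∃ s : G.Pure i, playedSeqs s = A := by
  let s : Finset (Finset (List α) × α) := A.biUnion Subtype.val
  have hs : ∀ m, m ∈ s ↔ ∃ w ∈ A, m ∈ w.1 := fun m => by simp only [s, Finset.mem_biUnion]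
  have hcons : ∀ {h : List α} (_ : h ∈ G.nodes (some i)) {a : α},
      (G.cell (some i) h, a) ∈ s → ∃ hH : a :: h ∈ G.H, G.seqAt (some i) (a :: h) hH ∈ A := by
    intro h hn a ha
    obtain ⟨w, hw, hm⟩ := (hs _).1 ha
    obtain ⟨x, hx, e⟩ := w.exists_eq
    rw [e] at hm
    obtain ⟨h', hsuf, hj, hc⟩ := exists_suffix_of_mem_seqSet hm
    have hH' := mem_H_of_suffix hsuf hx
    have hn' : h' ∈ G.nodes (some i) := hj ▸ mem_nodes_of_cons_mem hH'
    have hH : a :: h ∈ G.H := by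
      rw [← G.mem_actions, actions_eq_of_cell_eq hn hn' hc, G.mem_actions]
      exact hH'
    refine ⟨hH, hA.mem_of_le ?_ hw⟩
    change G.seqSet (some i) (a :: h) ⊆ w.1
    rw [e]
    exact seqSet_cons_subset_of_mem hG hn hx hm
  -- The last move of `w` occurs in some sequence of `A`, which extends `w` by perfect recall, and
  -- `A` is closed under prefixes.
  have hmem : ∀ w : G.Seq (some i), w.1 ⊆ s ↔ w ∈ A := by
    intro w
    refine ⟨fun hw => ?_, fun hw m hm => (hs m).2 ⟨w, hw, hm⟩⟩
    by_cases hr : w = (tree hG i).root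
    · exact hr ▸ hA.root_mem
    obtain ⟨I, hI⟩ := (tree hG i).exists_kid w hr
    obtain ⟨h, hh⟩ := (G.info i).nonempty_of_mem_parts I.2
    have hn := mem_nodes_of_mem_part I.2 hh
    obtain ⟨a, ha, rfl⟩ := (mem_tree_kids hG hh).1 hI
    refine (hcons hn (hw ?_)).2
    change _ ∈ G.seqSet (some i) (a :: h)
    rw [seqSet_cons_of_eq (mem_nodes.1 hn).2.2]
    exact Finset.mem_insert_self _ _
  refine ⟨⟨s, mem_pureStrategies.2 ⟨fun m hm => ?_, fun h hn => ⟨fun hsub => ?_, fun a ha => ?_⟩⟩⟩,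
    Finset.ext fun w => mem_playedSeqs.trans (hmem w)⟩
  · obtain ⟨w, hw, hm⟩ := (hs m).1 hm
    obtain ⟨x, hx, e⟩ := w.exists_eq
    rw [e] at hm
    obtain ⟨h', hsuf, hj, hc⟩ := exists_suffix_of_mem_seqSet hm
    have hH' := mem_H_of_suffix hsuf hx
    have hn' : h' ∈ G.nodes (some i) := hj ▸ mem_nodes_of_cons_mem hH'
    exact Finset.mem_biUnion.2 ⟨h', hn', Finset.mem_image.2
      ⟨m.2, G.mem_actions.2 hH', Prod.ext hc.symm rfl⟩⟩
  · have hself := mem_cell_self hn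
    have hj := (mem_nodes.1 hn).2.2
    have hpar : (tree hG i).par ⟨_, cell_mem_parts hn⟩ ∈ A := by
      rw [← hmem, tree_par hG hself]; exact hsub
    obtain ⟨w, ⟨hw, hwA⟩, hu⟩ := hA.existsUnique_kid _ hpar
    obtain ⟨a, ha, rfl⟩ := (mem_tree_kids hG hself).1 hw
    refine ⟨a, (hmem _).2 hwA ?_, fun b hb => ?_⟩
    · change _ ∈ G.seqSet (some i) (a :: h)
      rw [seqSet_cons_of_eq hj]; exact Finset.mem_insert_self _ _
    · obtain ⟨hH, hbA⟩ := hcons hn hb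
      have := hu _ ⟨(mem_tree_kids hG hself).2 ⟨b, G.mem_actions.2 hH, rfl⟩, hbA⟩
      exact seqAt_cons_injective hG hn (congrArg Subtype.val this)
  · obtain ⟨hH, haA⟩ := hcons hn ha
    exact (seqSet_subset_of_suffix (some i) (List.suffix_cons a h)).trans ((hmem _).2 haA)

end ExtensiveGame

/-! ### Payoffs of pure strategies in terms of sequences -/

namespace ExtensiveGame

variable {N α : Type*} [DecidableEq N] [DecidableEq α] {G : ExtensiveGame N α}

theorem singleton_notMem_seqSet_none (h : List α) (a : α) :
    (({h} : Finset (List α)), a) ∉ G.seqSet none h := by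
  intro hm
  obtain ⟨h', hs, -, hc⟩ := exists_suffix_of_mem_seqSet hm
  obtain rfl : h = h' := Finset.singleton_injective hc
  have := hs.length_le
  simp at this

section played

variable [Fintype N]

open Classical in
-- Regrouping by party: a history is played iff every party takes all of its own moves on it. Chance
-- nodes off `h` impose no condition.
theorem played_eq (s : ∀ i, G.Pure i) (sc : G.ChancePure) {h : List α} (hh : h ∈ G.H) :
    G.played s sc h = (∏ j : N, if G.seqSet (some j) h ⊆ (s j).1 then (1 : ℝ) else 0) *
      ∏ x : {h // h ∈ G.nodes none},
        if ∀ a, (({x.1} : Finset (List α)), a) ∈ G.seqSet none h → (sc x : α) = a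
          then (1 : ℝ) else 0 := by
  induction h with
  | nil => simp [played, seqSet_nil]
  | cons a h ih =>
    rw [played, ih (G.tail_mem a h hh)]
    have hn := mem_nodes_of_cons_mem hh
    cases hj : G.mover h with
    | none =>
      rw [hj] at hn
      have h1 : ∀ j : N, G.seqSet (some j) (a :: h) = G.seqSet (some j) h := fun j =>
        seqSet_cons_of_ne (by simp [hj]) a
      simp only [h1, mul_assoc]
      congr 1
      have h2 : ∀ x : {h // h ∈ G.nodes none},
          (if ∀ b, (({x.1} : Finset (List α)), b) ∈ G.seqSet none (a :: h) → (sc x : α) = b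
            then (1 : ℝ) else 0) =
          (if ∀ b, (({x.1} : Finset (List α)), b) ∈ G.seqSet none h → (sc x : α) = b
            then (1 : ℝ) else 0) * if x = ⟨h, hn⟩ then (if (sc x : α) = a then 1 else 0) else 1 := by
        intro x
        rw [seqSet_cons_of_eq hj]
        simp only [Finset.mem_insert, cell, Prod.mk.injEq, Finset.singleton_inj]
        by_cases hx : x = ⟨h, hn⟩
        · subst hx
          simp [singleton_notMem_seqSet_none]
        · have hx' : x.1 ≠ h := fun e => hx (Subtype.ext e)
          simp [hx, hx']
      simp only [h2, Finset.prod_mul_distrib, Finset.prod_ite_eq', Finset.mem_univ, if_true]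
      congr 1
      simp [hn]
    | some i =>
      have h1 : G.seqSet none (a :: h) = G.seqSet none h := seqSet_cons_of_ne (by simp [hj]) a
      rw [h1, mul_right_comm]
      congr 1
      have h2 : ∀ j : N, (if G.seqSet (some j) (a :: h) ⊆ (s j).1 then (1 : ℝ) else 0) =
          (if G.seqSet (some j) h ⊆ (s j).1 then (1 : ℝ) else 0) *
            if j = i then (if (G.cell (some i) h, a) ∈ (s i).1 then 1 else 0) else 1 := by
        intro j
        by_cases hji : j = i
        · subst hji
          simp only [seqSet_cons_of_eq hj, Finset.insert_subset_iff]
          by_cases h3 : G.seqSet (some j) h ⊆ (s j).1 <;> simp [h3]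
        · rw [seqSet_cons_of_ne (by simpa [hj] using Ne.symm hji)]
          simp [hji]
      simp only [h2, Finset.prod_mul_distrib, Finset.prod_ite_eq', Finset.mem_univ, if_true]

end played

open Classical in
-- At a chance node off `h` the probabilities sum to `1`; at one on `h` only the action taken
-- survives.
theorem prod_chance_eq {h : List α} (hh : h ∈ G.H) :
    ∏ x : {h // h ∈ G.nodes none}, ∑ a : {a // a ∈ G.actions x.1}, G.chance x.1 a *
      (if ∀ b, (({x.1} : Finset (List α)), b) ∈ G.seqSet none h → (a : α) = b
        then (1 : ℝ) else 0) = ∏ m ∈ G.seqSet none h, ∏ x ∈ m.1, G.chance x m.2 := by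
  have hsum : ∀ x : {h // h ∈ G.nodes none},
      ∑ a : {a // a ∈ G.actions x.1}, G.chance x.1 a = 1 := fun x => by
    have hx := mem_nodes.1 x.2
    rw [← G.chance_sum x.1 hx.1 hx.2.1 hx.2.2]
    exact Finset.sum_coe_sort (G.actions x.1) (G.chance x.1)
  induction h with
  | nil =>
    simp only [seqSet_nil, Finset.notMem_empty, IsEmpty.forall_iff, implies_true, if_true, mul_one,
      hsum, Finset.prod_const_one, Finset.prod_empty]
  | cons a h ih =>
    have hn := mem_nodes_of_cons_mem hh
    have hH := G.tail_mem a h hh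
    by_cases hj : G.mover h = none
    · rw [hj] at hn
      rw [seqSet_cons_of_eq hj]
      change _ = ∏ m ∈ insert (({h} : Finset (List α)), a) (G.seqSet none h), _
      rw [Finset.prod_insert (singleton_notMem_seqSet_none h a), ← ih hH]
      have h2 : ∀ x : {h // h ∈ G.nodes none},
          (∑ b : {b // b ∈ G.actions x.1}, G.chance x.1 b *
            (if ∀ c, (({x.1} : Finset (List α)), c) ∈
              insert (G.cell none h, a) (G.seqSet none h) → (b : α) = c then (1 : ℝ) else 0)) =
          (if x = ⟨h, hn⟩ then G.chance h a else 1) *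
          ∑ b : {b // b ∈ G.actions x.1}, G.chance x.1 b *
            (if ∀ c, (({x.1} : Finset (List α)), c) ∈ G.seqSet none h → (b : α) = c
              then (1 : ℝ) else 0) := by
        intro x
        simp only [Finset.mem_insert, cell, Prod.mk.injEq, Finset.singleton_inj]
        by_cases hx : x = ⟨h, hn⟩
        · subst hx
          have h3 : ∑ b : {b // b ∈ G.actions h}, G.chance h b *
              (if ∀ c, (({h} : Finset (List α)), c) ∈ G.seqSet none h → (b : α) = c
                then (1 : ℝ) else 0) = 1 := by
            refine Eq.trans (Finset.sum_congr rfl fun b _ => ?_) (hsum ⟨h, hn⟩)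
            rw [if_pos fun c hc => absurd hc (singleton_notMem_seqSet_none h c), mul_one]
          rw [if_pos rfl, h3, mul_one]
          simp only [singleton_notMem_seqSet_none, or_false, true_and, forall_eq]
          rw [Finset.sum_eq_single (⟨a, G.mem_actions.2 hh⟩ : {b // b ∈ G.actions h})]
          · simp
          · intro b _ hb
            rw [if_neg fun e => hb (Subtype.ext e), mul_zero]
          · simp
        · have hx' : x.1 ≠ h := fun e => hx (Subtype.ext e)
          simp [hx, hx']
      simp only [h2, Finset.prod_mul_distrib, Finset.prod_ite_eq', Finset.mem_univ, if_true]
      simp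
    · rw [seqSet_cons_of_ne hj]
      exact ih hH

open Classical in
theorem sum_chanceMixed_mul {h : List α} (hh : h ∈ G.H) :
    ∑ sc : G.ChancePure, G.chanceMixed sc * (∏ x : {h // h ∈ G.nodes none},
        if ∀ a, (({x.1} : Finset (List α)), a) ∈ G.seqSet none h → (sc x : α) = a
          then (1 : ℝ) else 0) = G.chancePlan (G.seqAt none h hh) := by
  rw [chancePlan, seqAt, ← prod_chance_eq hh, Finset.prod_univ_sum, Fintype.piFinset_univ]
  exact Finset.sum_congr rfl fun sc _ => by rw [chanceMixed, ← Finset.prod_mul_distrib]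

variable [Fintype N]

open Classical in
-- The players randomize independently: the profiles with `s i = si` form a box, so the sum factors,
-- and the factor of each other player is its induced plan.
theorem sum_prod_indicator_mul (σ : G.MixedProfile) (i : N) (si : G.Pure i) {h : List α}
    (hh : h ∈ G.H) :
    ∑ s : (∀ j, G.Pure j) with s i = si,
      (∏ j : N, if G.seqSet (some j) h ⊆ (s j).1 then (1 : ℝ) else 0) *
        ∏ j ∈ Finset.univ.erase i, σ j (s j) =
    (if G.seqSet (some i) h ⊆ si.1 then 1 else 0) *
      ∏ j ∈ Finset.univ.erase i, G.inducedPlan σ j (G.seqAt (some j) h hh) := by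
  have h1 : (Finset.univ.filter fun s : ∀ j, G.Pure j => s i = si) =
      Fintype.piFinset (Function.update (fun _ => Finset.univ) i {si}) := by
    ext s
    simp only [Finset.mem_filter, Finset.mem_univ, true_and, Fintype.mem_piFinset]
    constructor
    · rintro rfl j
      by_cases hj : j = i
      · subst hj; simp
      · simp [Function.update_of_ne hj]
    · intro h
      simpa using h i
  have h2 : ∀ s : ∀ j, G.Pure j,
      (∏ j : N, if G.seqSet (some j) h ⊆ (s j).1 then (1 : ℝ) else 0) *
        ∏ j ∈ Finset.univ.erase i, σ j (s j) =
      ∏ j : N, (if G.seqSet (some j) h ⊆ (s j).1 then (1 : ℝ) else 0) *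
        if j = i then 1 else σ j (s j) := by
    intro s
    rw [Finset.prod_mul_distrib]
    congr 1
    rw [← Finset.mul_prod_erase Finset.univ _ (Finset.mem_univ i), if_pos rfl, one_mul]
    exact Finset.prod_congr rfl fun j hj => by rw [if_neg (Finset.ne_of_mem_erase hj)]
  simp only [h2]
  rw [h1, ← Finset.prod_univ_sum _ fun j (x : G.Pure j) =>
      (if G.seqSet (some j) h ⊆ x.1 then (1 : ℝ) else 0) * if j = i then 1 else σ j x,
    ← Finset.mul_prod_erase Finset.univ _ (Finset.mem_univ i)]
  congr 1
  · rw [Function.update_self, Finset.sum_singleton, if_pos rfl, mul_one]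
  · refine Finset.prod_congr rfl fun j hj => ?_
    have hj := Finset.ne_of_mem_erase hj
    simp only [Function.update_of_ne hj, hj, if_false]
    rfl

open Classical in
/-- The payoff of a pure strategy is the total payoff of the sequences that it plays. -/
theorem mixedPayoff_eq (σ : G.MixedProfile) (i : N) (si : G.Pure i) :
    G.mixedPayoff i si σ =
      ∑ w ∈ playedSeqs si, G.seqExpPayoff i w (G.inducedPlan σ) := by
  set F : (∀ j, G.Seq j) → ℝ := fun w =>
    ∏ j ∈ Finset.univ.erase (some i), G.withChance (G.inducedPlan σ) j (w j)
  have hZ : ∀ h ∈ G.Z, h ∈ G.H := fun h hh => (Finset.mem_filter.1 hh).1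
  -- Both payoffs become sums over terminal histories; for each `h` only the sequence profile of `h`
  -- itself contributes on this side.
  have hR : ∑ w ∈ playedSeqs si, G.seqExpPayoff i w (G.inducedPlan σ) =
      ∑ h ∈ G.Z, G.payoff i h * ∑ w : ∀ j, G.Seq j,
        if (w (some i)).1 ⊆ si.1 ∧ ∀ j, (w j).1 = G.seqSet j h then F w else 0 := by
    calc _ = ∑ w : (∀ j, G.Seq j) with (w (some i)).1 ⊆ si.1, G.seqPayoff i w * F w := by
          rw [← Finset.sum_fiberwise_of_maps_to (s := Finset.univ.filter
            fun w : ∀ j, G.Seq j => (w (some i)).1 ⊆ si.1) (t := playedSeqs si)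
            (g := fun w => w (some i))
            fun w hw => mem_playedSeqs.2 (Finset.mem_filter.1 hw).2]
          refine Finset.sum_congr rfl fun w hw => ?_
          rw [seqExpPayoff, Finset.filter_filter]
          refine Finset.sum_congr (Finset.filter_congr fun x _ => ?_) fun _ _ => rfl
          constructor
          · rintro rfl
            exact ⟨mem_playedSeqs.1 hw, rfl⟩
          · exact fun h => h.2
      _ = _ := by
          simp only [seqPayoff, Finset.sum_filter, Finset.mul_sum, Finset.sum_mul]
          rw [Finset.sum_comm (s := G.Z)]
          refine Finset.sum_congr rfl fun w _ => ?_
          by_cases hw : (w (some i)).1 ⊆ si.1 <;> simp [hw, ite_mul]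
  rw [hR]
  have hL : G.mixedPayoff i si σ = ∑ h ∈ G.Z, G.payoff i h *
      ((∑ s : (∀ j, G.Pure j) with s i = si,
        (∏ j : N, if G.seqSet (some j) h ⊆ (s j).1 then (1 : ℝ) else 0) *
          ∏ j ∈ Finset.univ.erase i, σ j (s j)) *
      ∑ sc : G.ChancePure, G.chanceMixed sc * (∏ x : {h // h ∈ G.nodes none},
        if ∀ a, (({x.1} : Finset (List α)), a) ∈ G.seqSet none h → (sc x : α) = a
          then (1 : ℝ) else 0)) := by
    simp only [mixedPayoff, purePayoff, Finset.sum_mul, Finset.mul_sum]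
    rw [Finset.sum_comm, Finset.sum_comm (s := G.Z)]
    refine Finset.sum_congr rfl fun sc _ => ?_
    rw [Finset.sum_comm]
    refine Finset.sum_congr rfl fun h hh => Finset.sum_congr rfl fun s _ => ?_
    rw [played_eq s sc (hZ h hh)]
    ring
  rw [hL]
  refine Finset.sum_congr rfl fun h hh => ?_
  congr 1
  rw [sum_chanceMixed_mul (hZ h hh), sum_prod_indicator_mul σ i si (hZ h hh)]
  rw [Finset.sum_eq_single_of_mem (fun j => G.seqAt j h (hZ h hh)) (Finset.mem_univ _)]
  · have h1 : (Finset.univ.erase (some i) : Finset (Option N)) =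
        Finset.insertNone (Finset.univ.erase i) := by
      ext j; cases j <;> simp
    have h2 : ∀ j, (G.seqAt j h (hZ h hh)).1 = G.seqSet j h := fun j => rfl
    simp only [h2, implies_true, and_true, F, h1, Finset.prod_insertNone]
    split_ifs
    · rw [one_mul, mul_comm]
      rfl
    · simp
  · intro w _ hw
    refine if_neg fun h' => hw (funext fun j => Subtype.ext (h'.2 j))

end ExtensiveGame

/-! ### Limit points and proper equilibria -/

theorem sum_indicator_mul {W : Type*} [Fintype W] [DecidableEq W] (S : Finset W) (f : W → ℝ) :
    ∑ w, (if w ∈ S then 1 else 0) * f w = ∑ w ∈ S, f w := by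
  simp [ite_mul]

/-- A point is a cluster point of a sequence of points satisfying approximate conditions with
vanishing errors iff it can be approximated by such points. -/
theorem exists_seq_mapClusterPt_iff {X : Type*} [PseudoMetricSpace X] {P : ℝ → X → Prop}
    (mono : ∀ ε ε' x, ε ≤ ε' → P ε x → P ε' x) (x : X) :
    (∃ (ε : ℕ → ℝ) (τ : ℕ → X), (∀ k, 0 < ε k) ∧ Filter.Tendsto ε Filter.atTop (nhds 0) ∧
      (∀ k, P (ε k) (τ k)) ∧ MapClusterPt x Filter.atTop τ) ↔
    ∀ ε > 0, ∃ y, P ε y ∧ dist y x < ε := by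
  constructor
  · rintro ⟨e, τ, -, he, hP, hx⟩ ε hε
    have h1 := mapClusterPt_iff_frequently.1 hx _ (Metric.ball_mem_nhds x hε)
    obtain ⟨k, hk, hk'⟩ := (h1.and_eventually (he.eventually_lt_const hε)).exists
    exact ⟨τ k, mono _ _ _ hk'.le (hP k), hk⟩
  · intro h
    choose y hy hd using h
    have hlim : Filter.Tendsto (fun k : ℕ => 1 / ((k : ℝ) + 1)) Filter.atTop (nhds 0) :=
      tendsto_one_div_add_atTop_nhds_zero_nat
    have hpos : ∀ k : ℕ, (0 : ℝ) < 1 / ((k : ℝ) + 1) := fun k => by positivity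
    refine ⟨_, fun k => y _ (hpos k), hpos, hlim, fun k => hy _ (hpos k), ?_⟩
    refine Filter.Tendsto.mapClusterPt (tendsto_iff_dist_tendsto_zero.2 ?_)
    exact squeeze_zero (fun _ => dist_nonneg) (fun k => (hd _ (hpos k)).le) hlim

namespace ExtensiveGame

variable {N α : Type*} [DecidableEq N] [DecidableEq α] {G : ExtensiveGame N α}

theorem inducedPlan_apply (σ : G.MixedProfile) (i : N) (w : G.Seq (some i)) :
    G.inducedPlan σ i w = ∑ s, (if w ∈ playedSeqs s then 1 else 0) * σ i s :=
  Finset.sum_congr rfl fun s _ => by simp only [mem_playedSeqs]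

theorem continuous_inducedPlan : Continuous (G.inducedPlan) := by
  unfold inducedPlan
  fun_prop

theorem inducedPlan_mem_planProfiles (hG : G.PerfectRecall) {σ : G.MixedProfile}
    (hσ : σ ∈ G.mixedProfiles) : G.inducedPlan σ ∈ G.planProfiles := by
  intro i
  have h : ∀ w, G.inducedPlan σ i w = ∑ s, (if w ∈ playedSeqs s then 1 else 0) * σ i s :=
    inducedPlan_apply σ i
  refine (mem_plans_iff hG).2 ⟨?_, fun w => ?_, fun I => ?_⟩
  · rw [h]
    refine Eq.trans (Finset.sum_congr rfl fun s _ => ?_) (hσ i).2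
    rw [if_pos (isPure_playedSeqs hG s).root_mem, one_mul]
  · rw [h]
    exact Finset.sum_nonneg fun s _ => mul_nonneg (by split_ifs <;> norm_num) ((hσ i).1 s)
  · simp only [h]
    refine DecisionTree.IsFlow.sum _ (fun s _ I => ?_) I
    rw [← Finset.sum_mul, (isPure_playedSeqs hG s).isFlow I]

variable [Fintype N]

theorem IsEpsNormalFormProper.mono {ε ε' : ℝ} (h : ε ≤ ε') {σ : G.MixedProfile}
    (hσ : G.IsEpsNormalFormProper ε σ) : G.IsEpsNormalFormProper ε' σ :=
  ⟨hσ.1, hσ.2.1, fun i s s' hlt => (hσ.2.2 i s s' hlt).trans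
    (mul_le_mul_of_nonneg_right h (hσ.2.1 i s').le)⟩

theorem IsEpsSequenceFormProper.mono {ε ε' : ℝ} (h : ε ≤ ε') {γ : G.PlanProfile}
    (hγ : G.IsEpsSequenceFormProper ε γ) : G.IsEpsSequenceFormProper ε' γ :=
  ⟨hγ.1, hγ.2.1, fun i w w' hlt => (hγ.2.2 i w w' hlt).trans
    (mul_le_mul_of_nonneg_right h (hγ.2.1 i w').le)⟩

theorem isNormalFormProper_iff (σ : G.MixedProfile) : G.IsNormalFormProper σ ↔
    σ ∈ G.mixedProfiles ∧ ∀ ε > 0, ∃ τ, G.IsEpsNormalFormProper ε τ ∧ dist τ σ < ε :=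
  and_congr_right fun _ => exists_seq_mapClusterPt_iff (fun _ _ _ h hσ => hσ.mono h) σ

theorem isSequenceFormProper_iff (γ : G.PlanProfile) : G.IsSequenceFormProper γ ↔
    γ ∈ G.planProfiles ∧ ∀ ε > 0, ∃ η, G.IsEpsSequenceFormProper ε η ∧ dist η γ < ε :=
  and_congr_right fun _ => exists_seq_mapClusterPt_iff (fun _ _ _ h hγ => hγ.mono h) γ

/-- Against a given profile, the payoffs of player `i` are governed by a loss function. -/
theorem exists_payoff_loss (hG : G.PerfectRecall) (i : N) (γ : G.PlanProfile) :
    ∃ (V : ℝ) (L : G.Seq (some i) → ℝ), (tree hG i).IsLoss L ∧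
      (∀ w, G.maxPayoff i w γ = V - DecisionTree.pathLoss L w) ∧
      ∀ s : G.Pure i, ∑ w ∈ playedSeqs s, G.seqExpPayoff i w γ =
        V - ∑ w ∈ playedSeqs s, L w := by
  classical
  obtain ⟨V, L, hL, h⟩ := (tree hG i).exists_loss fun w => G.seqExpPayoff i w γ
  have hpure : ∀ S, (tree hG i).IsPure S →
      ∑ w ∈ S, G.seqExpPayoff i w γ = V - ∑ w ∈ S, L w := by
    intro S hS
    simpa only [sum_indicator_mul, if_pos hS.root_mem, mul_one] using h _ hS.isFlow
  refine ⟨V, L, hL, fun w => IsGreatest.csSup_eq ⟨?_, ?_⟩, fun s => hpure _ (isPure_playedSeqs hG s)⟩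
  · obtain ⟨S, hS, hw, hsum⟩ := hL.exists_isPure_sum_eq w
    refine ⟨fun x => if x ∈ S then 1 else 0, ⟨(mem_plans_iff hG).2
      ⟨if_pos hS.root_mem, fun x => by split_ifs <;> norm_num, hS.isFlow⟩, if_pos hw⟩, ?_⟩
    rw [← hsum, ← hpure S hS]
    exact sum_indicator_mul S fun x => G.seqExpPayoff i x γ
  · rintro _ ⟨ρ, ⟨hρ, hw⟩, rfl⟩
    obtain ⟨h1, h0, hflow⟩ := (mem_plans_iff hG).1 hρ
    have h2 := h ρ hflow
    rw [h1, mul_one] at h2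
    change ∑ w, ρ w * G.seqExpPayoff i w γ ≤ _
    rw [h2]
    refine sub_le_sub_left ?_ V
    calc DecisionTree.pathLoss L w = ∑ x with x ≤ w, ρ x * L x := by
          unfold DecisionTree.pathLoss
          refine Finset.sum_congr (by congr) fun x hx => ?_
          -- Commitment to `w` forces probability one on all its prefixes, so their losses are
          -- incurred in full.
          have h3 : ρ x = 1 := le_antisymm (h1 ▸ hflow.antitone h0 ((tree hG i).root_le x))
            (hw ▸ hflow.antitone h0 (Finset.mem_filter.1 hx).2)
          rw [h3, one_mul]
      _ ≤ ∑ x, ρ x * L x := Finset.sum_le_sum_of_subset_of_nonneg (Finset.filter_subset _ _)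
          fun x _ _ => mul_nonneg (h0 x) (hL.nonneg x)

theorem IsEpsNormalFormProper.inducedPlan (hG : G.PerfectRecall) {δ ε : ℝ} (hδ : 0 ≤ δ)
    (hδε : ∀ i, Fintype.card (G.Pure i) * δ ≤ ε) {σ : G.MixedProfile}
    (hσ : G.IsEpsNormalFormProper δ σ) : G.IsEpsSequenceFormProper ε (G.inducedPlan σ) := by
  have hsurj : ∀ i S, (tree hG i).IsPure S → ∃ s : G.Pure i, playedSeqs s = S :=
    fun i S hS => exists_playedSeqs_eq hG hS
  have hpos : ∀ i w, 0 < G.inducedPlan σ i w := by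
    intro i w
    obtain ⟨V, L, hL, -⟩ := exists_payoff_loss hG i (G.inducedPlan σ)
    obtain ⟨S, hS, hw, -⟩ := hL.exists_isPure_sum_eq w
    obtain ⟨s, rfl⟩ := hsurj i S hS
    rw [inducedPlan_apply]
    exact Finset.sum_pos' (fun t _ => mul_nonneg (by split_ifs <;> norm_num) (hσ.2.1 i t).le)
      ⟨s, Finset.mem_univ s, by simpa [hw] using hσ.2.1 i s⟩
  refine ⟨inducedPlan_mem_planProfiles hG hσ.1, hpos, fun i w w' hlt => ?_⟩
  obtain ⟨V, L, hL, hmax, hpay⟩ := exists_payoff_loss hG i (G.inducedPlan σ)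
  rw [hmax, hmax] at hlt
  refine le_trans ?_ (mul_le_mul_of_nonneg_right (hδε i) (hpos i w').le)
  rw [inducedPlan_apply, inducedPlan_apply]
  exact DecisionTree.le_of_forall_pure_le hL (isPure_playedSeqs hG) (hsurj i) hδ
    (fun p => (hσ.2.1 i p).le) (fun s s' hss => hσ.2.2 i s s' (by
      rw [mixedPayoff_eq, mixedPayoff_eq, hpay, hpay]; linarith)) (sub_lt_sub_iff_left V |>.1 hlt)

theorem isNormalFormProper_iff_isSequenceFormProper (hG : G.PerfectRecall)
    {σ : G.MixedProfile} {γ : G.PlanProfile} (hT : (σ, γ) ∈ G.inducedPairs) :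
    G.IsNormalFormProper σ ↔ G.IsSequenceFormProper γ := by
  obtain ⟨hσ, rfl⟩ : σ ∈ G.mixedProfiles ∧ γ = G.inducedPlan σ := hT
  rw [isNormalFormProper_iff, isSequenceFormProper_iff]
  refine and_congr (iff_of_true hσ (inducedPlan_mem_planProfiles hG hσ)) ⟨fun h ε hε => ?_,
    fun h ε hε => ?_⟩
  · obtain ⟨d, hd, hcont⟩ :=
      Metric.continuous_iff.1 (continuous_inducedPlan (G := G)) σ ε hε
    -- One constant dominating the number of pure strategies of every player; the `+ 1` keeps it
    -- positive when there are no players.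
    have hM : (0 : ℝ) < ∑ i, (Fintype.card (G.Pure i) : ℝ) + 1 := by positivity
    obtain ⟨τ, hτ, hdist⟩ := h (min d (ε / (∑ i, (Fintype.card (G.Pure i) : ℝ) + 1)))
      (by positivity)
    refine ⟨_, hτ.inducedPlan hG (by positivity) fun i => ?_,
      hcont τ (hdist.trans_le (min_le_left _ _))⟩
    calc _ ≤ (∑ i, (Fintype.card (G.Pure i) : ℝ) + 1) *
          (ε / (∑ i, (Fintype.card (G.Pure i) : ℝ) + 1)) := by
          gcongr
          · exact (Finset.single_le_sum (f := fun i => (Fintype.card (G.Pure i) : ℝ))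
              (fun _ _ => by positivity) (Finset.mem_univ i)).trans (by simp)
          · exact min_le_right _ _
      _ = ε := mul_div_cancel₀ _ hM.ne'
  · have key := fun i => DecisionTree.exists_mixed (isPure_playedSeqs hG (i := i))
      (fun S hS => exists_playedSeqs_eq hG hS) (hσ i).1 (hσ i).2 hε
    choose d hd hmix using key
    obtain ⟨δ, hδd, hδ⟩ : ∃ δ : ℝ, (∀ i, δ ∈ Set.Ioc 0 (d i)) ∧ δ ∈ Set.Ioi 0 :=
      ((Filter.eventually_all.2 fun i => Ioc_mem_nhdsGT (hd i)).and self_mem_nhdsWithin).exists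
    obtain ⟨η, hη, hdist⟩ := h δ hδ
    choose V L hL hmax hpay using fun i => exists_payoff_loss hG i η
    have hτ := fun i => by
      obtain ⟨h1, -, h2⟩ := (mem_plans_iff hG).1 (hη.1 i)
      refine hmix i (η i) (L i) (hL i) h2 h1 (hη.2.1 i) (fun w => ?_) fun w x hwx => ?_
      · have h3 := (dist_le_pi_dist (η i) (G.inducedPlan σ i) w).trans
          ((dist_le_pi_dist η (G.inducedPlan σ) i).trans (hdist.le.trans (hδd i).2))
        rwa [Real.dist_eq, inducedPlan_apply] at h3
      · refine (hη.2.2 i w x (by rw [hmax, hmax]; linarith)).trans ?_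
        exact mul_le_mul_of_nonneg_right (hδd i).2 (hη.2.1 i x).le
    choose τ hτpos hτsum hτdist hτproper using hτ
    -- As `τ` induces `η` exactly, payoffs against `τ` are governed by the losses computed against
    -- `η`.
    have hind : G.inducedPlan τ = η := by
      ext i w
      rw [inducedPlan_apply, ← hτsum i w]
    refine ⟨τ, ⟨fun i => ⟨fun s => (hτpos i s).le, ?_⟩, hτpos, fun i s s' hlt => ?_⟩, ?_⟩
    · rw [← ((mem_plans_iff hG).1 (hη.1 i)).1, ← hτsum]
      exact Finset.sum_congr rfl fun s _ => by
        rw [if_pos (isPure_playedSeqs hG s).root_mem, one_mul]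
    · refine hτproper i s s' ?_
      rw [mixedPayoff_eq, mixedPayoff_eq, hind, hpay, hpay] at hlt
      linarith
    · refine (dist_pi_lt_iff hε).2 fun i => (dist_pi_lt_iff hε).2 fun s => ?_
      rw [Real.dist_eq]
      exact hτdist i s

end ExtensiveGame

theorem theorem2 {N α : Type*} [Fintype N] [DecidableEq N] [DecidableEq α]
    (G : ExtensiveGame N α) (hG : G.PerfectRecall)
    (σ : G.MixedProfile) (γ : G.PlanProfile) (hT : (σ, γ) ∈ G.inducedPairs) :
    G.IsNormalFormProper σ ↔ G.IsSequenceFormProper γ :=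
  ExtensiveGame.isNormalFormProper_iff_isSequenceFormProper hG hT
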